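/- Let $M$ be a finite-dimensional smooth manifold (possibly with boundary), $\mathfrak g$ a finite-dimensional real Lie algebra, $n\ge 0$ an integer and $\langle\cdots\rangle:\mathfrak g^{n+1}\to W$ a symmetric $\mathbb R$-multilinear map with values in a finite-dimensional real vector space $W$ (for instance $W=\mathbb C$) which is $\mathfrak g$-invariant, i.e. $\sum_i\langle X_1,\dots,[Y,X_i],\dots,X_{n+1}\rangle=0$ for all $Y,X_1,\dots,X_{n+1}\in\mathfrak g$. For $\mathfrak g$-valued forms $Z_i$, $\langle Z_1\cdots Z_{n+1}\rangle$ denotes the $W$-valued form obtained by applying $\langle\cdots\rangle$ to the values and the wedge product to the form parts. Gauge connections are smooth $\mathfrak g$-valued one-forms $A$ on $M$, with curvature $F=dA+\tfrac12[A,A]$. (For a connection on a non-trivial principal bundle, $M$ may be taken to be the total space, on which the connection is a $\mathfrak g$-valued one-form, or an open subset of the base over which the bundle is trivialised.) For connections $A,\bar A$ define the transgression form $$Q^{(2n+1)}_{A\leftarrow\bar A}=(n+1)\int_0^1dt\,\big\langle(A-\bar A)\,F_t^{\,n}\big\rangle,\qquad F_t=\text{curvature of }\bar A+t(A-\bar A),$$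 and for connections $A_0,A_1,A_2$ define the $2n$-form $$Q^{(2n)}_{A_2\leftarrow A_1\leftarrow A_0}=n(n+1)\int_0^1dt\int_0^tds\,\big\langle(A_2-A_1)(A_1-A_0)F_{t,s}^{\,n-1}\big\rangle,$$ where $F_{t,s}$ is the curvature of $A_0+t(A_1-A_0)+s(A_2-A_1)$ (for $n=0$ this form is $0$ by convention). Then for any three gauge connections $A_0,A_1,A_2$ the form $Q^{(2n)}_{A_2\leftarrow A_1\leftarrow A_0}$ is smooth and the Triangle Equation holds: $$Q^{(2n+1)}_{A_2\leftarrow A_0}=Q^{(2n+1)}_{A_2\leftarrow A_1}+Q^{(2n+1)}_{A_1\leftarrow A_0}+d\,Q^{(2n)}_{A_2\leftarrow A_1\leftarrow A_0}.$$ Moreover, let $\pi:M\to B$ be a smooth surjective submersion onto a finite-dimensional smooth manifold $B$ (for instance a bundle projection). If $q_{20},q_{21},q_{10}$ and $q_{210}$ are forms on $B$, with $q_{210}$ smooth, whose pullbacks under $\pi$ are $Q^{(2n+1)}_{A_2\leftarrow A_0}$, $Q^{(2n+1)}_{A_2\leftarrow A_1}$, $Q^{(2n+1)}_{A_1\leftarrow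 A_0}$ and $Q^{(2n)}_{A_2\leftarrow A_1\leftarrow A_0}$ respectively, then $q_{20}=q_{21}+q_{10}+d\,q_{210}$ on $B$. -/

import Mathlib

open Set Topology MeasureTheory
open scoped Manifold ContDiff Nat

noncomputable section

/-! ### Lie algebras with a norm

The norm only serves to speak about smoothness and integrals; on a finite-dimensional real Lie
algebra any norm may be used. -/

/-- A Lie ring whose additive group is normed (no compatibility of norm and bracket required). -/
class NormedLieRing (𝔤 : Type*) extends NormedAddCommGroup 𝔤, LieRing 𝔤

/-- A real Lie algebra whose underlying vector space is a real normed space. -/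
class NormedLieAlgebra (𝔤 : Type*) [NormedLieRing 𝔤] extends NormedSpace ℝ 𝔤, LieAlgebra ℝ 𝔤

/-! ### Multilinear maps applied to alternating forms -/

section Algebra

variable {V : Type*} [AddCommGroup V] [Module ℝ V] [TopologicalSpace V]
  {N : Type*} [AddCommGroup N] [Module ℝ N] [TopologicalSpace N]
  {W : Type*} [AddCommGroup W] [Module ℝ W] [TopologicalSpace W]

variable (V N) in
/-- An alternating form on `V` with values in `N`, together with its degree. -/
abbrev GradedForm := Σ p : ℕ, V [⋀^Fin p]→L[ℝ] N

/-- The continuous multilinear map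
`(v₁, …, v_m) ↦ L (Z₁ (v₁, …, v_{p₁}), Z₂ (v_{p₁+1}, …, v_{p₁+p₂}), …)`, where `pᵢ` is the degree
of `Zᵢ` and `m = ∑ pᵢ`: successive blocks of arguments are inserted into the successive `Zᵢ`. -/
def blockComp {r m : ℕ} (L : ContinuousMultilinearMap ℝ (fun _ : Fin r => N) W)
    (Z : Fin r → GradedForm V N) (h : ∑ i, (Z i).1 = m) :
    ContinuousMultilinearMap ℝ (fun _ : Fin m => V) W where
  toMultilinearMap :=
    (L.toMultilinearMap.compMultilinearMap
      (fun i => (Z i).2.toContinuousMultilinearMap.toMultilinearMap)).domDomCongr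
      (finSigmaFinEquiv.trans (finCongr h))
  cont := by
    refine L.cont.comp (continuous_pi fun i => (Z i).2.cont.comp (continuous_pi fun j => ?_))
    exact continuous_apply _

theorem blockComp_apply {r m : ℕ} (L : ContinuousMultilinearMap ℝ (fun _ : Fin r => N) W)
    (Z : Fin r → GradedForm V N) (h : ∑ i, (Z i).1 = m) (v : Fin m → V) :
    blockComp L Z h v = L fun i => (Z i).2 fun j => v (finCongr h (finSigmaFinEquiv ⟨i, j⟩)) :=
  rfl

/-- The form `⟨Z₁ Z₂ ⋯ Z_r⟩`: a multilinear map `L = ⟨⋯⟩` applied to vector-valued alternating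
forms `Zᵢ` of degrees `pᵢ`, whose arguments are multiplied by the wedge product,
`(1 / ∏ pᵢ!) ∑_σ sign σ • L (Z₁ (v_{σ 1}, …, v_{σ p₁}), Z₂ (v_{σ (p₁+1)}, …), …)`.
This is the normalisation of the wedge product that goes with the exterior derivative
`dα (u, v) = D_u α (v) - D_v α (u)`. -/
def wedgeEval [IsTopologicalAddGroup W] [ContinuousConstSMul ℝ W] {r m : ℕ}
    (L : ContinuousMultilinearMap ℝ (fun _ : Fin r => N) W)
    (Z : Fin r → GradedForm V N) (h : ∑ i, (Z i).1 = m) : V [⋀^Fin m]→L[ℝ] W :=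
  (∏ i, ((Z i).1 ! : ℝ))⁻¹ • ContinuousMultilinearMap.alternatization (blockComp L Z h)

end Algebra

section Lie

variable {𝔤 : Type*} [NormedLieRing 𝔤] [NormedLieAlgebra 𝔤]

/-- The Lie bracket of a finite-dimensional Lie algebra as a continuous multilinear map. -/
def lieBracketMultilinear (𝔤 : Type*) [NormedLieRing 𝔤] [NormedLieAlgebra 𝔤]
    [FiniteDimensional ℝ 𝔤] : ContinuousMultilinearMap ℝ (fun _ : Fin 2 => 𝔤) 𝔤 where
  toFun v := ⁅v 0, v 1⁆
  map_update_add' v i x y := by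
    fin_cases i <;> simp [Function.update]
  map_update_smul' v i c x := by
    fin_cases i <;> simp [Function.update]
  cont := by
    let B : 𝔤 →ₗ[ℝ] 𝔤 →L[ℝ] 𝔤 :=
      { toFun := fun x => LinearMap.toContinuousLinearMap (LieAlgebra.ad ℝ 𝔤 x : 𝔤 →ₗ[ℝ] 𝔤)
        map_add' := fun x y => by ext z; simp
        map_smul' := fun c x => by ext z; simp }
    have hB : Continuous B := B.continuous_of_finiteDimensional
    exact (hB.comp (continuous_apply (0 : Fin 2))).clm_apply (continuous_apply (1 : Fin 2))

/-- A symmetric `𝔤`-invariant polynomial of rank `r`, in polarised form. Invariance means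
`∑ᵢ ⟨X₁, …, [Y, Xᵢ], …, X_r⟩ = 0`. -/
structure IsInvariantPolynomial {W : Type*} [NormedAddCommGroup W] [NormedSpace ℝ W] {r : ℕ}
    (L : ContinuousMultilinearMap ℝ (fun _ : Fin r => 𝔤) W) : Prop where
  symmetric : ∀ (σ : Equiv.Perm (Fin r)) (X : Fin r → 𝔤), L (X ∘ σ) = L X
  invariant : ∀ (Y : 𝔤) (X : Fin r → 𝔤), ∑ i, L (Function.update X i ⁅Y, X i⁆) = 0

end Lie

/-! ### Differential forms on a manifold -/

section Forms

variable {E : Type*} [NormedAddCommGroup E] [NormedSpace ℝ E]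
  {H : Type*} [TopologicalSpace H] (I : ModelWithCorners ℝ E H)
  {M : Type*} [TopologicalSpace M] [ChartedSpace H M]
  {F : Type*} [NormedAddCommGroup F] [NormedSpace ℝ F] {k : ℕ}

variable (M F k) in
/-- Differential `k`-forms on `M` with values in `F` (no regularity imposed). -/
abbrev DiffForm := (x : M) → TangentSpace I x [⋀^Fin k]→L[ℝ] F

variable {I}

/-- The coordinate representation of a form in the chart around `x₀`: its pullback under the
inverse of the chart. -/
def formInChart (α : DiffForm I M F k) (x₀ : M) : E → E [⋀^Fin k]→L[ℝ] F := fun y =>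
  (α ((extChartAt I x₀).symm y)).compContinuousLinearMap
    (mfderivWithin 𝓘(ℝ, E) I (extChartAt I x₀).symm (range I) y)

/-- A form is smooth if it is smooth in every chart. -/
def IsSmoothForm (α : DiffForm I M F k) : Prop :=
  ∀ x₀ : M, ContDiffOn ℝ ∞ (formInChart α x₀) (extChartAt I x₀).target

/-- The exterior derivative of a form on a manifold: at `x`, the exterior derivative of the
coordinate representation in the chart around `x`, pulled back under that chart. -/
def extDerivForm (α : DiffForm I M F k) : DiffForm I M F (k + 1) := fun x =>
  (extDerivWithin (formInChart α x) (range I) (extChartAt I x x)).compContinuousLinearMap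
    (mfderiv I 𝓘(ℝ, E) (extChartAt I x) x)

/-- The integral `∫_a^b α_t dt` of a one-parameter family of forms, taken pointwise on `M`. -/
def integralForm (a b : ℝ) (α : ℝ → DiffForm I M F k) : DiffForm I M F k := fun x =>
  (∫ t in a..b, (show E [⋀^Fin k]→L[ℝ] F from α t x) : E [⋀^Fin k]→L[ℝ] F)

/-- The pullback `f^* α` of a form under a map between manifolds. -/
def pullbackForm {E' : Type*} [NormedAddCommGroup E'] [NormedSpace ℝ E']
    {H' : Type*} [TopologicalSpace H'] {J : ModelWithCorners ℝ E' H'}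
    {B : Type*} [TopologicalSpace B] [ChartedSpace H' B]
    (f : M → B) (α : DiffForm J B F k) : DiffForm I M F k := fun x =>
  (α (f x)).compContinuousLinearMap (mfderiv I J f x)

end Forms

/-! ### Curvature, transgression forms and the boundary form of the triangle equation -/

section Gauge

variable {E : Type*} [NormedAddCommGroup E] [NormedSpace ℝ E]
  {H : Type*} [TopologicalSpace H] {I : ModelWithCorners ℝ E H}
  {M : Type*} [TopologicalSpace M] [ChartedSpace H M]
  {𝔤 : Type*} [NormedLieRing 𝔤] [NormedLieAlgebra 𝔤]
  {W : Type*} [NormedAddCommGroup W] [NormedSpace ℝ W]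

/-- The bracket `[P, Q]` of two `𝔤`-valued one-forms,
`[P, Q] (u, v) = [P u, Q v] - [P v, Q u]`. -/
def formBracket [FiniteDimensional ℝ 𝔤] (P Q : DiffForm I M 𝔤 1) : DiffForm I M 𝔤 2 := fun x =>
  wedgeEval (lieBracketMultilinear 𝔤) ![⟨1, P x⟩, ⟨1, Q x⟩] (by simp [Fin.sum_univ_two])

/-- The curvature `F = dA + A²` of a gauge connection `A`, where `A² = ½ [A, A]`. -/
def curvature [FiniteDimensional ℝ 𝔤] (A : DiffForm I M 𝔤 1) : DiffForm I M 𝔤 2 :=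
  extDerivForm A + (1 / 2 : ℝ) • formBracket A A

/-- The form `⟨θ Fⁿ⟩` of degree `2n + 1`, for a one-form `θ` and a two-form `F`. -/
def polyOne {n : ℕ} (L : ContinuousMultilinearMap ℝ (fun _ : Fin (n + 1) => 𝔤) W)
    (θ : DiffForm I M 𝔤 1) (F : DiffForm I M 𝔤 2) : DiffForm I M W (2 * n + 1) := fun x =>
  wedgeEval L (Fin.cons ⟨1, θ x⟩ fun _ => ⟨2, F x⟩) (by simp [Fin.sum_univ_succ]; ring)

/-- The form `⟨θ η Fᵐ⟩` of degree `2 (m + 1)`, for one-forms `θ`, `η` and a two-form `F`. -/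
def polyTwo {m : ℕ} (L : ContinuousMultilinearMap ℝ (fun _ : Fin (m + 2) => 𝔤) W)
    (θ η : DiffForm I M 𝔤 1) (F : DiffForm I M 𝔤 2) : DiffForm I M W (2 * (m + 1)) := fun x =>
  wedgeEval L (Fin.cons ⟨1, θ x⟩ (Fin.cons ⟨1, η x⟩ fun _ => ⟨2, F x⟩))
    (by simp [Fin.sum_univ_succ]; ring)

/-- The transgression form
`Q_{A₁ ← A₀} = (n + 1) ∫₀¹ dt ⟨(A₁ - A₀) F_tⁿ⟩`, `F_t` the curvature of `A₀ + t (A₁ - A₀)`. -/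
def transgression [FiniteDimensional ℝ 𝔤] {n : ℕ}
    (L : ContinuousMultilinearMap ℝ (fun _ : Fin (n + 1) => 𝔤) W)
    (A₁ A₀ : DiffForm I M 𝔤 1) : DiffForm I M W (2 * n + 1) :=
  ((n : ℝ) + 1) •
    integralForm 0 1 fun t => polyOne L (A₁ - A₀) (curvature (A₀ + t • (A₁ - A₀)))

/-- The boundary form
`Q_{A₂ ← A₁ ← A₀} = n (n + 1) ∫₀¹ dt ∫₀ᵗ ds ⟨(A₂ - A₁) (A₁ - A₀) F_tⁿ⁻¹⟩`, `F_t` the curvature of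
`A₀ + t (A₁ - A₀) + s (A₂ - A₁)`. For `n = 0` the prefactor vanishes and the form is zero. -/
def boundaryForm [FiniteDimensional ℝ 𝔤] : {n : ℕ} →
    (L : ContinuousMultilinearMap ℝ (fun _ : Fin (n + 1) => 𝔤) W) →
    (A₂ A₁ A₀ : DiffForm I M 𝔤 1) → DiffForm I M W (2 * n)
  | 0, _, _, _, _ => 0
  | m + 1, L, A₂, A₁, A₀ =>
    (((m + 1 : ℕ) : ℝ) * (((m + 1 : ℕ) : ℝ) + 1)) •
      integralForm 0 1 fun t => integralForm 0 t fun s =>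
        polyTwo L (A₂ - A₁) (A₁ - A₀) (curvature (A₀ + t • (A₁ - A₀) + s • (A₂ - A₁)))

end Gauge

end

/-! ### Signed sums over permutations of the arguments -/

section PermSum

variable {V W : Type*} [AddCommGroup W] {m : ℕ}

/-- The signed sum of `f (v ∘ σ)` over all permutations `σ`. -/
noncomputable def permSum (f : (Fin m → V) → W) (v : Fin m → V) : W :=
  ∑ σ : Equiv.Perm (Fin m), Equiv.Perm.sign σ • f (v ∘ σ)

theorem permSum_add (f g : (Fin m → V) → W) (v : Fin m → V) :
    permSum (fun w => f w + g w) v = permSum f v + permSum g v := by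
  simp [permSum, Finset.sum_add_distrib]

theorem permSum_smul [Module ℝ W] (c : ℝ) (f : (Fin m → V) → W) (v : Fin m → V) :
    permSum (fun w => c • f w) v = c • permSum f v := by
  simp only [permSum, Finset.smul_sum]
  exact Fintype.sum_congr _ _ fun σ => smul_comm _ _ _

theorem permSum_neg (f : (Fin m → V) → W) (v : Fin m → V) :
    permSum (fun w => -f w) v = -permSum f v := by
  simp [permSum]

theorem permSum_sum {ι : Type*} (s : Finset ι) (f : ι → (Fin m → V) → W) (v : Fin m → V) :
    permSum (fun w => ∑ i ∈ s, f i w) v = ∑ i ∈ s, permSum (f i) v := by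
  simp only [permSum, Finset.smul_sum]
  exact Finset.sum_comm

theorem permSum_comp_perm (τ : Equiv.Perm (Fin m)) (f : (Fin m → V) → W) (v : Fin m → V) :
    permSum (fun w => f (w ∘ τ)) v = Equiv.Perm.sign τ • permSum f v := by
  simp only [permSum, Finset.smul_sum]
  refine Fintype.sum_equiv (Equiv.mulRight τ) _ _ fun σ => ?_
  simp only [Equiv.coe_mulRight, Equiv.Perm.sign_mul, Equiv.Perm.coe_mul, Function.comp_assoc,
    smul_smul]
  rw [mul_comm (Equiv.Perm.sign σ), ← mul_assoc, Int.units_mul_self, one_mul]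

theorem permSum_comp_swap {i j : Fin m} (hij : i ≠ j) (f : (Fin m → V) → W) (v : Fin m → V) :
    permSum (fun w => f (w ∘ Equiv.swap i j)) v = -permSum f v := by
  rw [permSum_comp_perm, Equiv.Perm.sign_swap hij, Units.neg_smul, one_smul]

theorem permSum_comp_swap_mul_swap {i j k l : Fin m} (hij : i ≠ j) (hkl : k ≠ l)
    (f : (Fin m → V) → W) (v : Fin m → V) :
    permSum (fun w => f (w ∘ (Equiv.swap i j * Equiv.swap k l : Equiv.Perm (Fin m)))) v =
      permSum f v := by
  rw [permSum_comp_perm, Equiv.Perm.sign_mul, Equiv.Perm.sign_swap hij, Equiv.Perm.sign_swap hkl]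
  simp

theorem two_smul_permSum [Module ℝ W] {i j : Fin m} (hij : i ≠ j) (f : (Fin m → V) → W)
    (v : Fin m → V) :
    (2 : ℝ) • permSum f v = permSum (fun w => f w - f (w ∘ Equiv.swap i j)) v := by
  simp only [sub_eq_add_neg]
  rw [permSum_add, permSum_neg, permSum_comp_swap hij, two_smul, neg_neg]

/-- A signed sum vanishes if the cyclic sum over three of the arguments vanishes. -/
theorem permSum_eq_zero_of_cyclic [Module ℝ W] {i j k : Fin m} (hij : i ≠ j) (hjk : j ≠ k)
    (f : (Fin m → V) → W)
    (hf : ∀ w, f w + f (w ∘ (Equiv.swap i j * Equiv.swap j k : Equiv.Perm (Fin m))) +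
      f (w ∘ (Equiv.swap j k * Equiv.swap i j : Equiv.Perm (Fin m))) = 0) (v : Fin m → V) :
    permSum f v = 0 := by
  have h : permSum (fun w => f w + f (w ∘ (Equiv.swap i j * Equiv.swap j k : Equiv.Perm (Fin m))) +
      f (w ∘ (Equiv.swap j k * Equiv.swap i j : Equiv.Perm (Fin m)))) v = (3 : ℝ) • permSum f v := by
    rw [permSum_add, permSum_add, permSum_comp_swap_mul_swap hij hjk,
      permSum_comp_swap_mul_swap hjk hij]
    module
  simp only [hf] at h
  have h3 : (3 : ℝ) • permSum f v = 0 := by rw [← h]; simp [permSum]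
  exact (smul_eq_zero.1 h3).resolve_left (by norm_num)

/-- The permutations of `Fin (m + 1)`, sorted by the image of `0`. -/
theorem bijective_cycleRange_inv_mul_decomposeFin (m : ℕ) :
    Function.Bijective fun p : Fin (m + 1) × Equiv.Perm (Fin m) =>
      ((Fin.cycleRange p.1)⁻¹ * Equiv.Perm.decomposeFin.symm (0, p.2) :
        Equiv.Perm (Fin (m + 1))) := by
  rw [Fintype.bijective_iff_injective_and_card]
  constructor
  · rintro ⟨i, σ⟩ ⟨j, τ⟩ h
    have hij : i = j := by
      have := congrArg (fun e : Equiv.Perm (Fin (m + 1)) => e 0) h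
      simpa [Equiv.Perm.inv_def, Fin.cycleRange_symm_zero] using this
    subst hij
    have h' := mul_left_cancel h
    have := Equiv.Perm.decomposeFin.symm.injective h'
    simp_all
  · simp [Fintype.card_perm, Nat.factorial_succ]

theorem sum_neg_one_pow_smul_permSum (g : V → (Fin m → V) → W) (v : Fin (m + 1) → V) :
    ∑ i : Fin (m + 1), (-1 : ℤ) ^ (i : ℕ) • permSum (g (v i)) (i.removeNth v) =
      permSum (fun w => g (w 0) (Fin.tail w)) v := by
  simp only [permSum, Finset.smul_sum]
  rw [← Fintype.sum_prod_type', ← (bijective_cycleRange_inv_mul_decomposeFin m).sum_comp]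
  refine Fintype.sum_congr _ _ fun p => ?_
  have h0 : (v ∘ ((Fin.cycleRange p.1)⁻¹ * Equiv.Perm.decomposeFin.symm (0, p.2) :
      Equiv.Perm (Fin (m + 1)))) 0 = v p.1 := by
    simp [Equiv.Perm.inv_def, Fin.cycleRange_symm_zero]
  have h1 : Fin.tail (v ∘ ((Fin.cycleRange p.1)⁻¹ * Equiv.Perm.decomposeFin.symm (0, p.2) :
      Equiv.Perm (Fin (m + 1)))) = p.1.removeNth v ∘ p.2 := by
    ext j
    simp [Fin.tail, Equiv.Perm.inv_def, Fin.cycleRange_symm_succ, Fin.removeNth]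
  rw [h0, h1, Equiv.Perm.sign_mul, Equiv.Perm.sign_inv, Fin.sign_cycleRange,
    Equiv.Perm.decomposeFin.symm_sign]
  simp only [if_true, one_mul, mul_smul, Units.smul_def]
  push_cast
  rfl

end PermSum

/-! ### Explicit formulas for the forms `⟨θ F₁ ⋯ Fₙ⟩` and `⟨θ η F₁ ⋯ Fₘ⟩` -/

section Explicit

variable {V : Type*} [AddCommGroup V] [Module ℝ V] [TopologicalSpace V]
  {N : Type*} [AddCommGroup N] [Module ℝ N] [TopologicalSpace N]
  {W : Type*} [AddCommGroup W] [Module ℝ W] [TopologicalSpace W]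
  [IsTopologicalAddGroup W] [ContinuousConstSMul ℝ W]

/-- The form `⟨θ F₁ ⋯ Fₙ⟩` for a one-form `θ` and two-forms `Fᵢ`. -/
noncomputable def oneTwo {n : ℕ} (L : ContinuousMultilinearMap ℝ (fun _ : Fin (n + 1) => N) W)
    (θ : V [⋀^Fin 1]→L[ℝ] N) (F : Fin n → V [⋀^Fin 2]→L[ℝ] N) : V [⋀^Fin (2 * n + 1)]→L[ℝ] W :=
  wedgeEval L (Fin.cons ⟨1, θ⟩ fun i => ⟨2, F i⟩) (by simp [Fin.sum_univ_succ]; ring)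

/-- The form `⟨θ η F₁ ⋯ Fₘ⟩` for one-forms `θ`, `η` and two-forms `Fᵢ`. -/
noncomputable def oneOneTwo {m : ℕ} (L : ContinuousMultilinearMap ℝ (fun _ : Fin (m + 2) => N) W)
    (θ η : V [⋀^Fin 1]→L[ℝ] N) (F : Fin m → V [⋀^Fin 2]→L[ℝ] N) :
    V [⋀^Fin (2 * (m + 1))]→L[ℝ] W :=
  wedgeEval L (Fin.cons ⟨1, θ⟩ (Fin.cons ⟨1, η⟩ fun i => ⟨2, F i⟩))
    (by simp [Fin.sum_univ_succ]; ring)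

theorem wedgeEval_apply {r m : ℕ} (L : ContinuousMultilinearMap ℝ (fun _ : Fin r => N) W)
    (Z : Fin r → GradedForm V N) (h : ∑ i, (Z i).1 = m) (v : Fin m → V) :
    wedgeEval L Z h v = (∏ i, ((Z i).1 ! : ℝ))⁻¹ •
      permSum (fun w => L fun i => (Z i).2 fun j => w (finCongr h (finSigmaFinEquiv ⟨i, j⟩))) v := by
  rw [wedgeEval, ContinuousAlternatingMap.smul_apply,
    ContinuousMultilinearMap.alternatization_apply_apply]
  rfl

theorem oneTwo_apply {n : ℕ} (L : ContinuousMultilinearMap ℝ (fun _ : Fin (n + 1) => N) W)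
    (θ : V [⋀^Fin 1]→L[ℝ] N) (F : Fin n → V [⋀^Fin 2]→L[ℝ] N) (v : Fin (2 * n + 1) → V) :
    oneTwo L θ F v = ((2 : ℝ) ^ n)⁻¹ • permSum (fun w => L (Fin.cons (θ ![w 0])
      fun i : Fin n => F i ![w ⟨2 * i + 1, by omega⟩, w ⟨2 * i + 2, by omega⟩])) v := by
  rw [oneTwo, wedgeEval_apply]
  congr 1
  · simp [Fin.prod_univ_succ]
  · congr 1
    funext w
    congr 1
    funext i
    refine Fin.cases ?_ (fun i => ?_) i
    · refine congrArg θ (funext fun j : Fin 1 => ?_)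
      fin_cases j
      refine congrArg w (Fin.ext ?_)
      simp [finSigmaFinEquiv_apply]
    · refine congrArg (F i) (funext fun j : Fin 2 => ?_)
      fin_cases j
      all_goals
        refine congrArg w (Fin.ext ?_)
        simp [finSigmaFinEquiv_apply, Fin.sum_univ_succ]
        ring

theorem oneOneTwo_apply {m : ℕ} (L : ContinuousMultilinearMap ℝ (fun _ : Fin (m + 2) => N) W)
    (θ η : V [⋀^Fin 1]→L[ℝ] N) (F : Fin m → V [⋀^Fin 2]→L[ℝ] N) (v : Fin (2 * (m + 1)) → V) :
    oneOneTwo L θ η F v = ((2 : ℝ) ^ m)⁻¹ • permSum (fun w => L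
      (Fin.cons (θ ![w ⟨0, by omega⟩]) (Fin.cons (η ![w ⟨1, by omega⟩])
        fun i : Fin m => F i ![w ⟨2 * i + 2, by omega⟩, w ⟨2 * i + 3, by omega⟩]))) v := by
  rw [oneOneTwo, wedgeEval_apply]
  congr 1
  · simp [Fin.prod_univ_succ]
  · congr 1
    funext w
    congr 1
    funext i
    refine Fin.cases ?_ (fun i => Fin.cases ?_ (fun i => ?_) i) i
    · refine congrArg θ (funext fun j : Fin 1 => ?_)
      fin_cases j
      refine congrArg w (Fin.ext ?_)
      simp [finSigmaFinEquiv_apply]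
    · refine congrArg η (funext fun j : Fin 1 => ?_)
      fin_cases j
      refine congrArg w (Fin.ext ?_)
      simp only [finCongr_apply, Fin.val_cast, finSigmaFinEquiv_apply]
      exact congrArg (· + 0) (Fin.sum_univ_one _)
    · refine congrArg (F i) (funext fun j : Fin 2 => ?_)
      fin_cases j
      all_goals
        refine congrArg w (Fin.ext ?_)
        simp [finSigmaFinEquiv_apply, Fin.sum_univ_succ]
        ring

end Explicit

theorem swap_mul_swap_apply {α : Type*} [DecidableEq α] {a b c d : α} (hac : a ≠ c) (had : a ≠ d)
    (hbc : b ≠ c) (hbd : b ≠ d) :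
    (Equiv.swap a b * Equiv.swap c d) a = b ∧ (Equiv.swap a b * Equiv.swap c d) b = a ∧
      (Equiv.swap a b * Equiv.swap c d) c = d ∧ (Equiv.swap a b * Equiv.swap c d) d = c ∧
      ∀ x, x ≠ a → x ≠ b → x ≠ c → x ≠ d → (Equiv.swap a b * Equiv.swap c d) x = x := by
  refine ⟨?_, ?_, ?_, ?_, fun x h1 h2 h3 h4 => ?_⟩ <;>
    simp only [Equiv.Perm.coe_mul, Function.comp_apply]
  · rw [Equiv.swap_apply_of_ne_of_ne hac had, Equiv.swap_apply_left]
  · rw [Equiv.swap_apply_of_ne_of_ne hbc hbd, Equiv.swap_apply_right]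
  · rw [Equiv.swap_apply_left, Equiv.swap_apply_of_ne_of_ne had.symm hbd.symm]
  · rw [Equiv.swap_apply_right, Equiv.swap_apply_of_ne_of_ne hac.symm hbc.symm]
  · rw [Equiv.swap_apply_of_ne_of_ne h3 h4, Equiv.swap_apply_of_ne_of_ne h1 h2]

section Symmetry

variable {V : Type*} [AddCommGroup V] [Module ℝ V] [TopologicalSpace V]
  {N : Type*} [AddCommGroup N] [Module ℝ N] [TopologicalSpace N]
  {W : Type*} [AddCommGroup W] [Module ℝ W] [TopologicalSpace W]

theorem oneTwo_update_eq_zero_update [IsTopologicalAddGroup W] [ContinuousConstSMul ℝ W] {m : ℕ}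
    (L : ContinuousMultilinearMap ℝ (fun _ : Fin (m + 2) => N) W)
    (hL : ∀ (σ : Equiv.Perm (Fin (m + 2))) (X : Fin (m + 2) → N), L (X ∘ σ) = L X)
    (θ : V [⋀^Fin 1]→L[ℝ] N) (F Z : V [⋀^Fin 2]→L[ℝ] N) (j : Fin (m + 1))
    (v : Fin (2 * (m + 1) + 1) → V) :
    oneTwo L θ (Function.update (fun _ => F) j Z) v =
      oneTwo L θ (Function.update (fun _ => F) 0 Z) v := by
  rcases eq_or_ne j 0 with rfl | hj
  · rfl
  have hj' : (j : ℕ) ≠ 0 := fun h => hj (Fin.ext h)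
  rw [oneTwo_apply, oneTwo_apply]
  congr 1
  rw [← permSum_comp_swap_mul_swap (i := ⟨1, by omega⟩) (j := ⟨2 * j + 1, by omega⟩)
    (k := ⟨2, by omega⟩) (l := ⟨2 * j + 2, by omega⟩) (by simp; omega) (by simp; omega)]
  congr 1
  funext w
  rw [← hL (Equiv.swap (Fin.succ 0) j.succ)]
  congr 1
  funext i
  obtain ⟨h1, h2, h3, h4, hw⟩ := swap_mul_swap_apply
    (a := (⟨1, by omega⟩ : Fin (2 * (m + 1) + 1))) (b := ⟨2 * j + 1, by omega⟩)
    (c := ⟨2, by omega⟩) (d := ⟨2 * j + 2, by omega⟩)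
    (by simp only [ne_eq, Fin.mk.injEq]; omega) (by simp only [ne_eq, Fin.mk.injEq]; omega)
    (by simp only [ne_eq, Fin.mk.injEq]; omega) (by simp only [ne_eq, Fin.mk.injEq]; omega)
  refine Fin.cases ?_ (fun i => ?_) i
  · rw [Function.comp_apply, Equiv.swap_apply_of_ne_of_ne (Fin.succ_ne_zero _).symm
      (Fin.succ_ne_zero _).symm, Fin.cons_zero, Fin.cons_zero, Function.comp_apply, hw]
    all_goals
      intro h
      have := congrArg Fin.val h
      simp only [Fin.val_zero] at this
      omega
  · rcases eq_or_ne i j with rfl | hij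
    · rw [Function.comp_apply, Equiv.swap_apply_right, Fin.cons_succ, Fin.cons_succ,
        Function.update_of_ne hj, Function.update_of_ne hj.symm]
      exact congrArg F (congrArg₂ (fun x y => ![x, y]) (congrArg w h1) (congrArg w h3))
    · rcases eq_or_ne i 0 with rfl | hi
      · rw [Function.comp_apply, Equiv.swap_apply_left, Fin.cons_succ, Fin.cons_succ,
          Function.update_self, Function.update_self, Function.comp_apply, Function.comp_apply,
          h2, h4]
        rfl
      · have hi' : (i : ℕ) ≠ 0 := fun h => hi (Fin.ext h)
        have hij' : (i : ℕ) ≠ j := fun h => hij (Fin.ext h)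
        rw [Function.comp_apply, Equiv.swap_apply_of_ne_of_ne
            (fun h => hi (Fin.succ_injective _ h)) (fun h => hij (Fin.succ_injective _ h)),
          Fin.cons_succ, Fin.cons_succ, Function.comp_apply, Function.comp_apply, hw, hw,
          Function.update_of_ne hij, Function.update_of_ne hi]
        all_goals
          simp only [ne_eq, Fin.mk.injEq]
          omega

/-- Replacing one of the two-forms in `⟨θ Fᵐ⁺¹⟩`: by symmetry all positions give the same form. -/
theorem oneTwo_update_apply [IsTopologicalAddGroup W] [ContinuousConstSMul ℝ W] {m : ℕ}
    (L : ContinuousMultilinearMap ℝ (fun _ : Fin (m + 2) => N) W)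
    (hL : ∀ (σ : Equiv.Perm (Fin (m + 2))) (X : Fin (m + 2) → N), L (X ∘ σ) = L X)
    (θ : V [⋀^Fin 1]→L[ℝ] N) (F Z : V [⋀^Fin 2]→L[ℝ] N) (j : Fin (m + 1))
    (v : Fin (2 * (m + 1) + 1) → V) :
    oneTwo L θ (Function.update (fun _ => F) j Z) v = ((2 : ℝ) ^ (m + 1))⁻¹ • permSum (fun w => L
      (Fin.cons (θ ![w 0]) (Fin.cons (Z ![w ⟨1, by omega⟩, w ⟨2, by omega⟩]) fun i : Fin m =>
        F ![w ⟨2 * i + 3, by omega⟩, w ⟨2 * i + 4, by omega⟩]))) v := by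
  rw [oneTwo_update_eq_zero_update L hL, oneTwo_apply]
  congr 2
  funext w
  congr 1
  funext i
  refine Fin.cases rfl (fun i => Fin.cases ?_ (fun i => ?_) i) i
  · simp
  · simp [mul_add]

theorem map_cons_cons_swap {m : ℕ}
    (L : ContinuousMultilinearMap ℝ (fun _ : Fin (m + 2) => N) W)
    (hL : ∀ (σ : Equiv.Perm (Fin (m + 2))) (X : Fin (m + 2) → N), L (X ∘ σ) = L X)
    (x y : N) (Φ : Fin m → N) :
    L (Fin.cons x (Fin.cons y Φ)) = L (Fin.cons y (Fin.cons x Φ)) := by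
  rw [← hL (Equiv.swap 0 1)]
  congr 1
  funext i
  refine Fin.cases ?_ (fun i => Fin.cases ?_ (fun i => ?_) i) i
  · simp
  · simp
  · rw [Function.comp_apply, Equiv.swap_apply_of_ne_of_ne] <;> simp [Fin.ext_iff]

end Symmetry

section Koszul

variable {V : Type*} [AddCommGroup V] [Module ℝ V] [TopologicalSpace V]
  {𝔤 : Type*} [NormedLieRing 𝔤] [NormedLieAlgebra 𝔤]
  {W : Type*} [NormedAddCommGroup W] [NormedSpace ℝ W] {m : ℕ}

/-- By invariance, derivatives of the arguments of an invariant polynomial may be replaced by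
covariant derivatives. -/
theorem IsInvariantPolynomial.sum_update_add_lie {r : ℕ}
    {L : ContinuousMultilinearMap ℝ (fun _ : Fin r => 𝔤) W} (hL : IsInvariantPolynomial L)
    (Y : 𝔤) (X X' : Fin r → 𝔤) :
    ∑ i, L (Function.update X i (X' i)) = ∑ i, L (Function.update X i (X' i + ⁅Y, X i⁆)) := by
  simp [Finset.sum_add_distrib, hL.invariant]

theorem map_cons_sub_map_cons {r : ℕ} (L : ContinuousMultilinearMap ℝ (fun _ : Fin (r + 1) => 𝔤) W)
    (x y : 𝔤) (X : Fin r → 𝔤) :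
    L (Fin.cons x X) - L (Fin.cons y X) = L (Fin.cons (x - y) X) := by
  have h := L.map_update_sub (Fin.cons 0 X) 0 x y
  simpa [Fin.update_cons_zero] using h.symm

/-- The algebraic core of the triangle equation: the exterior derivative of `⟨b a Fᵐ⟩`, computed
from derivatives `b'`, `a'`, `F'` of the three forms that satisfy the Bianchi identity, in terms of
the covariant exterior derivatives `Da` and `Db`. -/
theorem IsInvariantPolynomial.sum_neg_one_pow_smul_oneOneTwo
    {L : ContinuousMultilinearMap ℝ (fun _ : Fin (m + 2) => 𝔤) W} (hL : IsInvariantPolynomial L)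
    {A a b : V [⋀^Fin 1]→L[ℝ] 𝔤} {F Da Db : V [⋀^Fin 2]→L[ℝ] 𝔤}
    {a' b' : V → V [⋀^Fin 1]→L[ℝ] 𝔤} {F' : V → V [⋀^Fin 2]→L[ℝ] 𝔤}
    (hDa : ∀ u v, Da ![u, v] = a' u ![v] + ⁅A ![u], a ![v]⁆ - (a' v ![u] + ⁅A ![v], a ![u]⁆))
    (hDb : ∀ u v, Db ![u, v] = b' u ![v] + ⁅A ![u], b ![v]⁆ - (b' v ![u] + ⁅A ![v], b ![u]⁆))
    (hF : ∀ u v w, (F' u ![v, w] + ⁅A ![u], F ![v, w]⁆) + (F' v ![w, u] + ⁅A ![v], F ![w, u]⁆) +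
      (F' w ![u, v] + ⁅A ![w], F ![u, v]⁆) = 0)
    (v : Fin (2 * (m + 1) + 1) → V) :
    ((m : ℝ) + 1) • ∑ i : Fin (2 * (m + 1) + 1), (-1 : ℤ) ^ (i : ℕ) •
      (oneOneTwo L (b' (v i)) a (fun _ => F) (i.removeNth v) +
        oneOneTwo L b (a' (v i)) (fun _ => F) (i.removeNth v) +
        ∑ j, oneOneTwo L b a (Function.update (fun _ => F) j (F' (v i))) (i.removeNth v)) =
    ∑ j, oneTwo L a (Function.update (fun _ => F) j Db) v -
      ∑ j, oneTwo L b (Function.update (fun _ => F) j Da) v := by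
  -- values of the two-forms on the last `2 m` arguments
  let Φ : (Fin (2 * (m + 1) + 1) → V) → Fin m → 𝔤 := fun w i =>
    F ![w ⟨2 * i + 3, by omega⟩, w ⟨2 * i + 4, by omega⟩]
  let e1 : Fin (2 * (m + 1) + 1) := ⟨1, by omega⟩
  let e2 : Fin (2 * (m + 1) + 1) := ⟨2, by omega⟩
  -- covariant derivatives
  let na : V → V → 𝔤 := fun x y => a' x ![y] + ⁅A ![x], a ![y]⁆
  let nb : V → V → 𝔤 := fun x y => b' x ![y] + ⁅A ![x], b ![y]⁆
  let nF : V → V → V → 𝔤 := fun x y z => F' x ![y, z] + ⁅A ![x], F ![y, z]⁆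
  let T1 : (Fin (2 * (m + 1) + 1) → V) → W := fun w =>
    L (Fin.cons (nb (w 0) (w e1)) (Fin.cons (a ![w e2]) (Φ w)))
  let T2 : (Fin (2 * (m + 1) + 1) → V) → W := fun w =>
    L (Fin.cons (b ![w e1]) (Fin.cons (na (w 0) (w e2)) (Φ w)))
  let T3 : Fin m → (Fin (2 * (m + 1) + 1) → V) → W := fun j w =>
    L (Fin.cons (b ![w e1]) (Fin.cons (a ![w e2]) (Function.update (Φ w) j
      (nF (w 0) (w ⟨2 * j + 3, by omega⟩) (w ⟨2 * j + 4, by omega⟩)))))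
  have h01 : (0 : Fin (2 * (m + 1) + 1)) ≠ e1 := fun h => by simpa [e1] using congrArg Fin.val h
  have h02 : (0 : Fin (2 * (m + 1) + 1)) ≠ e2 := fun h => by simpa [e2] using congrArg Fin.val h
  have h12 : e1 ≠ e2 := fun h => by simpa [e1, e2] using congrArg Fin.val h
  have hΦ : ∀ (τ : Equiv.Perm (Fin (2 * (m + 1) + 1))) (w : Fin (2 * (m + 1) + 1) → V),
      (∀ x, x ≠ 0 → x ≠ e1 → x ≠ e2 → τ x = x) → Φ (w ∘ τ) = Φ w := by
    intro τ w hτ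
    funext i
    simp only [Φ, Function.comp_apply]
    rw [hτ, hτ]
    all_goals
      intro h
      have := congrArg Fin.val h
      simp [e1, e2] at this
  have key : ∑ i : Fin (2 * (m + 1) + 1), (-1 : ℤ) ^ (i : ℕ) •
      (oneOneTwo L (b' (v i)) a (fun _ => F) (i.removeNth v) +
        oneOneTwo L b (a' (v i)) (fun _ => F) (i.removeNth v) +
        ∑ j, oneOneTwo L b a (Function.update (fun _ => F) j (F' (v i))) (i.removeNth v)) =
      ((2 : ℝ) ^ m)⁻¹ • permSum (fun w => T1 w + T2 w + ∑ j, T3 j w) v := by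
    let g : V → (Fin (2 * (m + 1)) → V) → W := fun u w =>
      L (Fin.cons (b' u ![w ⟨0, by omega⟩]) (Fin.cons (a ![w ⟨1, by omega⟩])
        fun i : Fin m => F ![w ⟨2 * i + 2, by omega⟩, w ⟨2 * i + 3, by omega⟩])) +
      L (Fin.cons (b ![w ⟨0, by omega⟩]) (Fin.cons (a' u ![w ⟨1, by omega⟩])
        fun i : Fin m => F ![w ⟨2 * i + 2, by omega⟩, w ⟨2 * i + 3, by omega⟩])) +
      ∑ j, L (Fin.cons (b ![w ⟨0, by omega⟩]) (Fin.cons (a ![w ⟨1, by omega⟩])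
        fun i : Fin m => (Function.update (fun _ => F) j (F' u) : Fin m → V [⋀^Fin 2]→L[ℝ] 𝔤) i
          ![w ⟨2 * i + 2, by omega⟩, w ⟨2 * i + 3, by omega⟩]))
    have hg : ∀ i : Fin (2 * (m + 1) + 1), (-1 : ℤ) ^ (i : ℕ) •
        (oneOneTwo L (b' (v i)) a (fun _ => F) (i.removeNth v) +
          oneOneTwo L b (a' (v i)) (fun _ => F) (i.removeNth v) +
          ∑ j, oneOneTwo L b a (Function.update (fun _ => F) j (F' (v i))) (i.removeNth v)) =
        ((2 : ℝ) ^ m)⁻¹ • ((-1 : ℤ) ^ (i : ℕ) • permSum (g (v i)) (i.removeNth v)) := by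
      intro i
      rw [smul_comm]
      simp only [oneOneTwo_apply, g, permSum_add, permSum_sum, smul_add, Finset.smul_sum]
    rw [Fintype.sum_congr _ _ hg, ← Finset.smul_sum, sum_neg_one_pow_smul_permSum]
    congr 2
    funext w
    have hu : ∀ (j : Fin m), (fun i : Fin m =>
        (Function.update (fun _ => F) j (F' (w 0)) : Fin m → V [⋀^Fin 2]→L[ℝ] 𝔤) i
          ![w ⟨2 * i + 3, by omega⟩, w ⟨2 * i + 4, by omega⟩]) =
        Function.update (Φ w) j
          (F' (w 0) ![w ⟨2 * j + 3, by omega⟩, w ⟨2 * j + 4, by omega⟩]) := by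
      intro j
      funext i
      rcases eq_or_ne i j with rfl | hij
      · simp
      · simp [hij, Φ]
    have h := hL.sum_update_add_lie (A ![w 0])
      (Fin.cons (b ![w e1]) (Fin.cons (a ![w e2]) (Φ w)))
      (Fin.cons (b' (w 0) ![w e1]) (Fin.cons (a' (w 0) ![w e2]) fun j =>
        F' (w 0) ![w ⟨2 * j + 3, by omega⟩, w ⟨2 * j + 4, by omega⟩]))
    simp only [Fin.sum_univ_succ, ← Fin.cons_update, Fin.update_cons_zero, Fin.cons_zero,
      Fin.cons_succ, ← add_assoc] at h
    refine Eq.trans ?_ h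
    simp only [g, ← hu]
    rfl
  have hT1 : (2 : ℝ) • permSum T1 v = permSum (fun w =>
      L (Fin.cons (a ![w 0]) (Fin.cons (Db ![w e1, w e2]) (Φ w)))) v := by
    rw [two_smul_permSum h01, ← permSum_comp_swap_mul_swap h12 h01 (fun w =>
      L (Fin.cons (a ![w 0]) (Fin.cons (Db ![w e1, w e2]) (Φ w))))]
    congr 1
    funext w
    simp only [T1]
    rw [hΦ, hΦ]
    · simp only [Function.comp_apply, Equiv.Perm.coe_mul, Equiv.swap_apply_left,
        Equiv.swap_apply_right, Equiv.swap_apply_of_ne_of_ne h02.symm h12.symm,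
        Equiv.swap_apply_of_ne_of_ne h01 h02]
      rw [map_cons_sub_map_cons, map_cons_cons_swap L hL.symmetric, hDb]
    · intro x h0 h1 h2
      simp only [Equiv.Perm.coe_mul, Function.comp_apply, Equiv.swap_apply_of_ne_of_ne h0 h1,
        Equiv.swap_apply_of_ne_of_ne h1 h2]
    · intro x h0 h1 h2
      rw [Equiv.swap_apply_of_ne_of_ne h0 h1]
  have hT2 : (2 : ℝ) • permSum T2 v = -permSum (fun w =>
      L (Fin.cons (b ![w 0]) (Fin.cons (Da ![w e1, w e2]) (Φ w)))) v := by
    rw [← neg_neg (permSum T2 v), ← permSum_comp_swap h01, smul_neg, two_smul_permSum h12]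
    congr 2
    funext w
    simp only [T2]
    rw [hΦ, hΦ, hΦ]
    · simp only [Function.comp_apply, Equiv.swap_apply_left,
        Equiv.swap_apply_right, Equiv.swap_apply_of_ne_of_ne h02.symm h12.symm,
        Equiv.swap_apply_of_ne_of_ne h01 h02]
      rw [map_cons_cons_swap L hL.symmetric, map_cons_cons_swap L hL.symmetric (b ![w 0]),
        map_cons_sub_map_cons, map_cons_cons_swap L hL.symmetric, hDa]
    all_goals
      intro x h0 h1 h2
      first
      | rw [Equiv.swap_apply_of_ne_of_ne h0 h1]
      | rw [Equiv.swap_apply_of_ne_of_ne h1 h2]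
  have hT3 : ∀ j, permSum (T3 j) v = 0 := by
    intro j
    have hp : (0 : Fin (2 * (m + 1) + 1)) ≠ ⟨2 * j + 3, by omega⟩ :=
      fun h => by simpa using congrArg Fin.val h
    have hq : (0 : Fin (2 * (m + 1) + 1)) ≠ ⟨2 * j + 4, by omega⟩ :=
      fun h => by simpa using congrArg Fin.val h
    have hpq : (⟨2 * j + 3, by omega⟩ : Fin (2 * (m + 1) + 1)) ≠ ⟨2 * j + 4, by omega⟩ :=
      fun h => by simpa using congrArg Fin.val h
    refine permSum_eq_zero_of_cyclic hp hpq _ (fun w => ?_) v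
    have hT : ∀ (τ : Equiv.Perm (Fin (2 * (m + 1) + 1))),
        (∀ x, x ≠ 0 → x ≠ ⟨2 * j + 3, by omega⟩ → x ≠ ⟨2 * j + 4, by omega⟩ → τ x = x) →
        T3 j (w ∘ τ) = L (Function.update
          (Fin.cons (b ![w e1]) (Fin.cons (a ![w e2]) (Φ w)) : Fin (m + 2) → 𝔤) j.succ.succ
            (nF (w (τ 0)) (w (τ ⟨2 * j + 3, by omega⟩)) (w (τ ⟨2 * j + 4, by omega⟩)))) := by
      intro τ hτ
      have hne : ∀ x : Fin (2 * (m + 1) + 1), (x : ℕ) ≠ 0 → (x : ℕ) ≠ 2 * j + 3 →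
          (x : ℕ) ≠ 2 * j + 4 → τ x = x := fun x h0 h1 h2 =>
        hτ x (fun h => h0 (by simp [h])) (fun h => h1 (by simp [h])) (fun h => h2 (by simp [h]))
      simp only [T3, ← Fin.cons_update, Function.comp_apply]
      rw [hne e1 (by simp [e1]) (by simp [e1]) (by simp [e1]),
        hne e2 (by simp [e2]) (by simp only [e2]; omega) (by simp only [e2]; omega)]
      congr 3
      funext i
      rcases eq_or_ne i j with rfl | hij
      · simp
      · have hij' : (i : ℕ) ≠ j := fun h => hij (Fin.ext h)
        simp only [Function.update_of_ne hij, Φ, Function.comp_apply]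
        rw [hne, hne]
        all_goals
          simp only
          omega
    have h1 : T3 j w = T3 j (w ∘ (1 : Equiv.Perm (Fin (2 * (m + 1) + 1)))) := rfl
    rw [h1, hT 1 fun _ _ _ _ => rfl, hT, hT]
    · simp only [Equiv.Perm.coe_mul, Equiv.Perm.coe_one, id, Function.comp_apply,
        Equiv.swap_apply_left, Equiv.swap_apply_right, Equiv.swap_apply_of_ne_of_ne hp hq,
        Equiv.swap_apply_of_ne_of_ne hq.symm hpq.symm]
      rw [← L.map_update_add, ← L.map_update_add]
      refine L.map_coord_zero j.succ.succ ?_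
      rw [Function.update_self]
      exact hF _ _ _
    all_goals
      intro x h0 h1 h2
      simp only [Equiv.Perm.coe_mul, Function.comp_apply, Equiv.swap_apply_of_ne_of_ne h0 h1,
        Equiv.swap_apply_of_ne_of_ne h1 h2]
  rw [key, permSum_add, permSum_add, permSum_sum, Finset.sum_eq_zero fun j _ => hT3 j, add_zero]
  simp only [oneTwo_update_apply L hL.symmetric, Finset.sum_const, Finset.card_univ,
    Fintype.card_fin]
  have e : ((2 : ℝ) ^ m)⁻¹ = ((2 : ℝ) ^ (m + 1))⁻¹ * 2 := by rw [pow_succ]; field_simp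
  rw [e, mul_smul, smul_add, hT1, hT2, ← smul_sub, ← Nat.cast_smul_eq_nsmul ℝ]
  push_cast
  rw [← sub_eq_add_neg, smul_sub]

end Koszul

/-! ### Regularity of alternating forms through their values -/

section Eval

variable {E : Type*} [NormedAddCommGroup E] [NormedSpace ℝ E] [FiniteDimensional ℝ E]
  {F : Type*} [NormedAddCommGroup F] [NormedSpace ℝ F] [FiniteDimensional ℝ F] {k : ℕ}

variable (E F k) in
/-- An alternating form is a linear function of finitely many of its values. -/
theorem exists_continuousLinearMap_eval_eq :
    ∃ G : ((Fin k → Fin (Module.finrank ℝ E)) → F) →L[ℝ] (E [⋀^Fin k]→L[ℝ] F),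
      ∀ α : E [⋀^Fin k]→L[ℝ] F, G (fun i => α fun j => Module.finBasis ℝ E (i j)) = α := by
  let ev : (E [⋀^Fin k]→L[ℝ] F) →ₗ[ℝ] ((Fin k → Fin (Module.finrank ℝ E)) → F) :=
    { toFun := fun α i => α fun j => Module.finBasis ℝ E (i j)
      map_add' := fun _ _ => rfl
      map_smul' := fun _ _ => rfl }
  have hev : LinearMap.ker ev = ⊥ := by
    refine LinearMap.ker_eq_bot.2 fun α β h => ?_
    refine ContinuousAlternatingMap.toAlternatingMap_injective ?_
    exact (Module.finBasis ℝ E).ext_alternating fun i _ => congrFun h i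
  obtain ⟨g, hg⟩ := ev.exists_leftInverse_of_injective hev
  exact ⟨LinearMap.toContinuousLinearMap g, fun α => LinearMap.congr_fun hg α⟩

theorem contDiffWithinAt_of_eval {X : Type*} [NormedAddCommGroup X] [NormedSpace ℝ X]
    {f : X → E [⋀^Fin k]→L[ℝ] F} {s : Set X} {x : X} {n : WithTop ℕ∞}
    (h : ∀ v, ContDiffWithinAt ℝ n (fun y => f y v) s x) : ContDiffWithinAt ℝ n f s x := by
  obtain ⟨G, hG⟩ := exists_continuousLinearMap_eval_eq E F k
  have : f = fun y => G fun i => f y fun j => Module.finBasis ℝ E (i j) := by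
    funext y; exact (hG _).symm
  rw [this]
  exact G.contDiff.comp_contDiffWithinAt (contDiffWithinAt_pi.2 fun i => h _)

theorem continuous_of_eval {X : Type*} [TopologicalSpace X] {f : X → E [⋀^Fin k]→L[ℝ] F}
    (h : ∀ v, Continuous fun y => f y v) : Continuous f := by
  obtain ⟨G, hG⟩ := exists_continuousLinearMap_eval_eq E F k
  have : f = fun y => G fun i => f y fun j => Module.finBasis ℝ E (i j) := by
    funext y; exact (hG _).symm
  rw [this]
  exact G.continuous.comp (continuous_pi fun i => h _)

omit [FiniteDimensional ℝ E] [FiniteDimensional ℝ F] in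
theorem ContDiffWithinAt.eval_form {X : Type*} [NormedAddCommGroup X] [NormedSpace ℝ X]
    {f : X → E [⋀^Fin k]→L[ℝ] F} {s : Set X} {x : X} {n : WithTop ℕ∞}
    (h : ContDiffWithinAt ℝ n f s x) (v : Fin k → E) :
    ContDiffWithinAt ℝ n (fun y => f y v) s x :=
  (ContinuousAlternatingMap.apply ℝ E F v).contDiff.comp_contDiffWithinAt h

omit [FiniteDimensional ℝ E] [FiniteDimensional ℝ F] in
theorem HasFDerivWithinAt.eval_form {X : Type*} [NormedAddCommGroup X] [NormedSpace ℝ X]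
    {f : X → E [⋀^Fin k]→L[ℝ] F} {f' : X →L[ℝ] E [⋀^Fin k]→L[ℝ] F} {s : Set X} {x : X}
    (h : HasFDerivWithinAt f f' s x) (v : Fin k → E) :
    HasFDerivWithinAt (fun y => f y v) ((ContinuousAlternatingMap.apply ℝ E F v).comp f') s x :=
  (ContinuousAlternatingMap.apply ℝ E F v).hasFDerivAt.comp_hasFDerivWithinAt x h

end Eval

/-! ### Differentiation of the forms `⟨θ F₁ ⋯ Fₙ⟩` and `⟨θ η F₁ ⋯ Fₘ⟩` -/

section Derivative

variable {X : Type*} [NormedAddCommGroup X] [NormedSpace ℝ X]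
  {E : Type*} [NormedAddCommGroup E] [NormedSpace ℝ E]
  {N : Type*} [NormedAddCommGroup N] [NormedSpace ℝ N]
  {W : Type*} [NormedAddCommGroup W] [NormedSpace ℝ W] {m : ℕ} {s : Set X} {x : X}

theorem ContDiffWithinAt.oneOneTwo [FiniteDimensional ℝ E] [FiniteDimensional ℝ W]
    {n : WithTop ℕ∞} (L : ContinuousMultilinearMap ℝ (fun _ : Fin (m + 2) => N) W)
    {θ η : X → E [⋀^Fin 1]→L[ℝ] N} {F : Fin m → X → E [⋀^Fin 2]→L[ℝ] N}
    (hθ : ContDiffWithinAt ℝ n θ s x) (hη : ContDiffWithinAt ℝ n η s x)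
    (hF : ∀ i, ContDiffWithinAt ℝ n (F i) s x) :
    ContDiffWithinAt ℝ n (fun y => oneOneTwo L (θ y) (η y) fun i => F i y) s x := by
  refine contDiffWithinAt_of_eval fun v => ?_
  simp only [oneOneTwo_apply, permSum]
  refine contDiffWithinAt_const.smul (ContDiffWithinAt.sum fun σ _ => ?_)
  simp only [Units.smul_def, ← Int.cast_smul_eq_zsmul ℝ]
  refine contDiffWithinAt_const.smul (L.contDiff.comp_contDiffWithinAt
    (contDiffWithinAt_pi.2 fun i => ?_))
  refine Fin.cases ?_ (fun i => Fin.cases ?_ (fun i => ?_) i) i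
  · exact hθ.eval_form _
  · exact hη.eval_form _
  · exact (hF i).eval_form _

theorem hasFDerivWithinAt_map_cons_cons
    (L : ContinuousMultilinearMap ℝ (fun _ : Fin (m + 2) => N) W)
    {p q : X → N} {r : Fin m → X → N} {p' q' : X →L[ℝ] N} {r' : Fin m → X →L[ℝ] N}
    (hp : HasFDerivWithinAt p p' s x) (hq : HasFDerivWithinAt q q' s x)
    (hr : ∀ i, HasFDerivWithinAt (r i) (r' i) s x) :
    ∃ D : X →L[ℝ] W, HasFDerivWithinAt
      (fun y => L (Fin.cons (p y) (Fin.cons (q y) fun i => r i y))) D s x ∧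
      ∀ u, D u = L (Fin.cons (p' u) (Fin.cons (q x) fun i => r i x)) +
        L (Fin.cons (p x) (Fin.cons (q' u) fun i => r i x)) +
        ∑ j, L (Fin.cons (p x) (Fin.cons (q x)
          (Function.update (fun i => r i x) j (r' j u)))) := by
  let g : Fin (m + 2) → X → N := Fin.cons p (Fin.cons q r)
  let g' : Fin (m + 2) → X →L[ℝ] N := Fin.cons p' (Fin.cons q' r')
  have hg : ∀ i, HasFDerivWithinAt (g i) (g' i) s x := fun i =>
    Fin.cases hp (fun i => Fin.cases hq hr i) i
  have hgy : ∀ y, (fun i => g i y) =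
      (Fin.cons (p y) (Fin.cons (q y) fun i => r i y) : Fin (m + 2) → N) := fun y =>
    funext fun i => Fin.cases rfl (fun i => Fin.cases rfl (fun i => rfl) i) i
  have h := HasFDerivWithinAt.multilinear_comp L hg
  simp only [hgy] at h
  refine ⟨_, h, fun u => ?_⟩
  simp only [Fin.sum_univ_succ, g', add_apply, sum_apply, ContinuousLinearMap.coe_comp,
    Function.comp_apply, ContinuousMultilinearMap.toContinuousLinearMap_apply, ← Fin.cons_update,
    Fin.update_cons_zero, Fin.cons_zero, Fin.cons_succ, ← add_assoc]

theorem fderivWithin_oneOneTwo_apply (L : ContinuousMultilinearMap ℝ (fun _ : Fin (m + 2) => N) W)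
    {θ η : X → E [⋀^Fin 1]→L[ℝ] N} {F : X → E [⋀^Fin 2]→L[ℝ] N}
    (hs : UniqueDiffWithinAt ℝ s x)
    (hθ : DifferentiableWithinAt ℝ θ s x) (hη : DifferentiableWithinAt ℝ η s x)
    (hF : DifferentiableWithinAt ℝ F s x) (v : Fin (2 * (m + 1)) → E) (u : X) :
    fderivWithin ℝ (fun y => oneOneTwo L (θ y) (η y) (fun _ => F y) v) s x u =
      oneOneTwo L (fderivWithin ℝ θ s x u) (η x) (fun _ => F x) v +
        oneOneTwo L (θ x) (fderivWithin ℝ η s x u) (fun _ => F x) v +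
        ∑ j, oneOneTwo L (θ x) (η x)
          (Function.update (fun _ => F x) j (fderivWithin ℝ F s x u)) v := by
  have h := fun w : Fin (2 * (m + 1)) → E => hasFDerivWithinAt_map_cons_cons L
    (hθ.hasFDerivWithinAt.eval_form ![w ⟨0, by omega⟩])
    (hη.hasFDerivWithinAt.eval_form ![w ⟨1, by omega⟩])
    (fun i : Fin m => hF.hasFDerivWithinAt.eval_form
      ![w ⟨2 * i + 2, by omega⟩, w ⟨2 * i + 3, by omega⟩])
  choose D hD hDu using h
  have hsum : HasFDerivWithinAt (fun y => oneOneTwo L (θ y) (η y) (fun _ => F y) v)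
      (((2 : ℝ) ^ m)⁻¹ • ∑ σ : Equiv.Perm (Fin (2 * (m + 1))),
        (((Equiv.Perm.sign σ : ℤˣ) : ℤ) : ℝ) • D (v ∘ σ)) s x := by
    simp only [oneOneTwo_apply, permSum]
    refine HasFDerivWithinAt.const_smul (HasFDerivWithinAt.fun_sum fun σ _ => ?_) _
    simp only [Units.smul_def, ← Int.cast_smul_eq_zsmul ℝ]
    exact (hD (v ∘ σ)).const_smul _
  rw [hsum.fderivWithin hs]
  have hperm : (((2 : ℝ) ^ m)⁻¹ • ∑ σ : Equiv.Perm (Fin (2 * (m + 1))),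
      (((Equiv.Perm.sign σ : ℤˣ) : ℤ) : ℝ) • D (v ∘ σ)) u =
      ((2 : ℝ) ^ m)⁻¹ • permSum (fun w => D w u) v := by
    simp only [smul_apply, sum_apply, Int.cast_smul_eq_zsmul, ← Units.smul_def, permSum]
  rw [hperm]
  simp only [hDu, permSum_add, permSum_sum]
  simp only [oneOneTwo_apply, smul_add, Finset.smul_sum]
  congr 1
  refine Fintype.sum_congr _ _ fun j => ?_
  congr 2
  funext w
  congr 3
  funext i
  rcases eq_or_ne i j with rfl | hij
  · simp
  · simp [hij]

end Derivative

/-! ### The triangle equation before integration, in a chart -/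

section Chart

variable {E : Type*} [NormedAddCommGroup E] [NormedSpace ℝ E]
  {𝔤 : Type*} [NormedLieRing 𝔤] [NormedLieAlgebra 𝔤] [FiniteDimensional ℝ 𝔤]
  {W : Type*} [NormedAddCommGroup W] [NormedSpace ℝ W] {m : ℕ} {s : Set E} {x : E}

/-- The Lie bracket of a finite-dimensional Lie algebra as a continuous bilinear map. -/
noncomputable def lieBracketCLM (𝔤 : Type*) [NormedLieRing 𝔤] [NormedLieAlgebra 𝔤]
    [FiniteDimensional ℝ 𝔤] : 𝔤 →L[ℝ] 𝔤 →L[ℝ] 𝔤 :=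
  LinearMap.toContinuousLinearMap
    { toFun := fun x => LinearMap.toContinuousLinearMap (LieAlgebra.ad ℝ 𝔤 x : 𝔤 →ₗ[ℝ] 𝔤)
      map_add' := fun x y => by ext z; simp
      map_smul' := fun c x => by ext z; simp }

theorem lieBracketCLM_apply (x y : 𝔤) : lieBracketCLM 𝔤 x y = ⁅x, y⁆ := rfl

omit [FiniteDimensional ℝ 𝔤] in
theorem extDerivWithin_one_apply (A : E → E [⋀^Fin 1]→L[ℝ] 𝔤) (s : Set E) (x u v : E) :
    extDerivWithin A s x ![u, v] =
      fderivWithin ℝ A s x u ![v] - fderivWithin ℝ A s x v ![u] := by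
  have h0 : (0 : Fin 2).removeNth ![u, v] = ![v] := by funext i; fin_cases i; rfl
  have h1 : (1 : Fin 2).removeNth ![u, v] = ![u] := by funext i; fin_cases i; rfl
  rw [extDerivWithin, ContinuousAlternatingMap.alternatizeUncurryFin_apply, Fin.sum_univ_two, h0,
    h1]
  simp [sub_eq_add_neg]

omit [FiniteDimensional ℝ 𝔤] in
theorem map_vecCons_two_swap (α : E [⋀^Fin 2]→L[ℝ] 𝔤) (u v : E) : α ![u, v] = -α ![v, u] := by
  rw [← α.coe_toAlternatingMap,
    ← α.toAlternatingMap.map_swap ![v, u] (show (0 : Fin 2) ≠ 1 by decide)]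
  congr 1
  funext i
  fin_cases i <;> rfl

omit [FiniteDimensional ℝ 𝔤] in
theorem extDerivWithin_two_apply (A : E → E [⋀^Fin 2]→L[ℝ] 𝔤) (s : Set E) (x u v w : E) :
    extDerivWithin A s x ![u, v, w] = fderivWithin ℝ A s x u ![v, w] +
      fderivWithin ℝ A s x v ![w, u] + fderivWithin ℝ A s x w ![u, v] := by
  have h0 : (0 : Fin 3).removeNth ![u, v, w] = ![v, w] := by funext i; fin_cases i <;> rfl
  have h1 : (1 : Fin 3).removeNth ![u, v, w] = ![u, w] := by funext i; fin_cases i <;> rfl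
  have h2 : (2 : Fin 3).removeNth ![u, v, w] = ![u, v] := by funext i; fin_cases i <;> rfl
  have h3 := map_vecCons_two_swap (fderivWithin ℝ A s x v) u w
  rw [extDerivWithin, ContinuousAlternatingMap.alternatizeUncurryFin_apply, Fin.sum_univ_three, h0,
    h1, h2]
  simp [h3]

theorem minSmoothness_two_le_infty : minSmoothness ℝ 2 ≤ ∞ := by
  rw [minSmoothness_of_isRCLikeNormedField]
  exact WithTop.coe_le_coe.2 (le_top : (2 : ℕ∞) ≤ ⊤)

/-- The Bianchi identity `dF + [A, F] = 0`. -/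
theorem bianchi {A : E → E [⋀^Fin 1]→L[ℝ] 𝔤} {F : E → E [⋀^Fin 2]→L[ℝ] 𝔤}
    (hs : UniqueDiffOn ℝ s) (hx : x ∈ s) (hxc : x ∈ closure (interior s))
    (hA : ContDiffWithinAt ℝ ∞ A s x) (hF : DifferentiableWithinAt ℝ F s x)
    (hFA : ∀ᶠ y in 𝓝[s] x, ∀ u v,
      F y ![u, v] = extDerivWithin A s y ![u, v] + ⁅A y ![u], A y ![v]⁆) (u v w : E) :
    (fderivWithin ℝ F s x u ![v, w] + ⁅A x ![u], F x ![v, w]⁆) +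
      (fderivWithin ℝ F s x v ![w, u] + ⁅A x ![v], F x ![w, u]⁆) +
      (fderivWithin ℝ F s x w ![u, v] + ⁅A x ![w], F x ![u, v]⁆) = 0 := by
  have hAd : DifferentiableWithinAt ℝ A s x := hA.differentiableWithinAt (by simp)
  have hdA : DifferentiableWithinAt ℝ (extDerivWithin A s) s x := by
    have h := (hA.fderivWithin_right (m := 1) hs (by norm_cast) hx).differentiableWithinAt (by simp)
    exact (ContinuousAlternatingMap.alternatizeUncurryFinCLM ℝ E 𝔤).differentiableAt
      |>.comp_differentiableWithinAt x h
  have hFx := hFA.self_of_nhdsWithin hx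
  have hF' : ∀ u v w, fderivWithin ℝ F s x u ![v, w] =
      fderivWithin ℝ (extDerivWithin A s) s x u ![v, w] +
        (⁅A x ![v], fderivWithin ℝ A s x u ![w]⁆ - ⁅A x ![w], fderivWithin ℝ A s x u ![v]⁆) := by
    intro u v w
    have h1 := (hdA.hasFDerivWithinAt.eval_form ![v, w]).add
      ((lieBracketCLM 𝔤).hasFDerivWithinAt_of_bilinear (hAd.hasFDerivWithinAt.eval_form ![v])
        (hAd.hasFDerivWithinAt.eval_form ![w]))
    have h2 : HasFDerivWithinAt (fun y => F y ![v, w]) _ s x := h1.congr_of_eventuallyEq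
      (hFA.mono fun y hy => hy v w) (hFx v w)
    have h3 := (hs x hx).eq (hF.hasFDerivWithinAt.eval_form ![v, w]) h2
    have h4 := DFunLike.congr_fun h3 u
    simp only [ContinuousLinearMap.coe_comp, Function.comp_apply,
      ContinuousAlternatingMap.apply_apply, add_apply, ContinuousLinearMap.precompR_apply,
      ContinuousLinearMap.precompL_apply, lieBracketCLM_apply] at h4
    rw [h4, ← lie_skew (A x ![w]), sub_neg_eq_add]
    rfl
  have hdd : extDerivWithin (extDerivWithin A s) s x ![u, v, w] = 0 := by
    rw [extDerivWithin_extDerivWithin_apply hA minSmoothness_two_le_infty hs hxc hx]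
    rfl
  rw [extDerivWithin_two_apply] at hdd
  simp only [hF', hFx, extDerivWithin_one_apply, lie_add, lie_sub]
  have h := congrArg₂ (· + ·) hdd (lie_jacobi (A x ![u]) (A x ![v]) (A x ![w]))
  simp only [add_zero] at h
  rw [← h]
  abel

/-- The exterior derivative of `⟨b a Fᵐ⟩` for the curvature `F` of a connection `A`, in terms of
the covariant exterior derivatives `Da` and `Db`. -/
theorem IsInvariantPolynomial.extDerivWithin_oneOneTwo [FiniteDimensional ℝ E]
    [FiniteDimensional ℝ W]
    {L : ContinuousMultilinearMap ℝ (fun _ : Fin (m + 2) => 𝔤) W} (hL : IsInvariantPolynomial L)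
    {A a b : E → E [⋀^Fin 1]→L[ℝ] 𝔤} {F : E → E [⋀^Fin 2]→L[ℝ] 𝔤} {Da Db : E [⋀^Fin 2]→L[ℝ] 𝔤}
    (hs : UniqueDiffOn ℝ s) (hx : x ∈ s) (hxc : x ∈ closure (interior s))
    (hA : ContDiffWithinAt ℝ ∞ A s x) (ha : ContDiffWithinAt ℝ ∞ a s x)
    (hb : ContDiffWithinAt ℝ ∞ b s x) (hF : ContDiffWithinAt ℝ ∞ F s x)
    (hFA : ∀ᶠ y in 𝓝[s] x, ∀ u v,
      F y ![u, v] = extDerivWithin A s y ![u, v] + ⁅A y ![u], A y ![v]⁆)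
    (hDa : ∀ u v, Da ![u, v] =
      extDerivWithin a s x ![u, v] + (⁅A x ![u], a x ![v]⁆ - ⁅A x ![v], a x ![u]⁆))
    (hDb : ∀ u v, Db ![u, v] =
      extDerivWithin b s x ![u, v] + (⁅A x ![u], b x ![v]⁆ - ⁅A x ![v], b x ![u]⁆)) :
    ((m : ℝ) + 1) • extDerivWithin (fun y => oneOneTwo L (b y) (a y) fun _ => F y) s x =
      ∑ j, oneTwo L (a x) (Function.update (fun _ => F x) j Db) -
        ∑ j, oneTwo L (b x) (Function.update (fun _ => F x) j Da) := by
  have had := ha.differentiableWithinAt (by simp)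
  have hbd := hb.differentiableWithinAt (by simp)
  have hFd := hF.differentiableWithinAt (by simp)
  have hd : DifferentiableWithinAt ℝ (fun y => oneOneTwo L (b y) (a y) fun _ => F y) s x :=
    (ContDiffWithinAt.oneOneTwo L hb ha fun _ => hF).differentiableWithinAt (by simp)
  ext v
  have hkey := hL.sum_neg_one_pow_smul_oneOneTwo (A := A x) (a := a x) (b := b x) (F := F x)
    (Da := Da) (Db := Db) (a' := fderivWithin ℝ a s x) (b' := fderivWithin ℝ b s x)
    (F' := fderivWithin ℝ F s x)
    (fun u v => by rw [hDa, extDerivWithin_one_apply]; abel)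
    (fun u v => by rw [hDb, extDerivWithin_one_apply]; abel)
    (bianchi hs hx hxc hA hFd hFA) v
  simp only [ContinuousAlternatingMap.smul_apply, ContinuousAlternatingMap.sub_apply,
    ContinuousAlternatingMap.sum_apply]
  rw [← hkey, extDerivWithin_apply hd (hs x hx)]
  congr 1
  refine Fintype.sum_congr _ _ fun i => ?_
  rw [fderivWithin_oneOneTwo_apply L (hs x hx) hbd had hFd]

end Chart

/-! ### Differential forms in charts -/

section Charts

variable {E : Type*} [NormedAddCommGroup E] [NormedSpace ℝ E]
  {H : Type*} [TopologicalSpace H] {I : ModelWithCorners ℝ E H}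
  {M : Type*} [TopologicalSpace M] [ChartedSpace H M] [IsManifold I ∞ M]
  {E' : Type*} [NormedAddCommGroup E'] [NormedSpace ℝ E']
  {H' : Type*} [TopologicalSpace H'] {J : ModelWithCorners ℝ E' H'}
  {B : Type*} [TopologicalSpace B] [ChartedSpace H' B] [IsManifold J ∞ B]
  {F : Type*} [NormedAddCommGroup F] [NormedSpace ℝ F] {k : ℕ}

omit [IsManifold J ∞ B] [TopologicalSpace B] [ChartedSpace H' B] [TopologicalSpace H'] in
theorem form_apply_congr {B : Type*} (q : B → E' [⋀^Fin k]→L[ℝ] F) {b b' : B} (h : b = b')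
    {v w : Fin k → E'} (hvw : v = w) : q b v = q b' w := by
  rw [h, hvw]

/-- A smooth map in charts is smooth. -/
theorem ContMDiff.contDiffWithinAt_inCharts {π : M → B} (hπ : ContMDiff I J ∞ π) {x₀ : M} {b₀ : B}
    {y : E} (hy : y ∈ (extChartAt I x₀).target)
    (hb : π ((extChartAt I x₀).symm y) ∈ (extChartAt J b₀).source) :
    ContDiffWithinAt ℝ ∞ (fun z => extChartAt J b₀ (π ((extChartAt I x₀).symm z))) (range I) y := by
  rw [← contMDiffWithinAt_iff_contDiffWithinAt]
  have h1 : ContMDiffAt J 𝓘(ℝ, E') ∞ (extChartAt J b₀) (π ((extChartAt I x₀).symm y)) :=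
    contMDiffAt_extChartAt' (by rwa [← extChartAt_source J])
  exact h1.comp_contMDiffWithinAt y (hπ.contMDiffAt.comp_contMDiffWithinAt y
    (contMDiffWithinAt_extChartAt_symm_range x₀ hy))

/-- The derivative of a smooth map in charts. -/
theorem ContMDiff.fderivWithin_inCharts {π : M → B} (hπ : ContMDiff I J ∞ π) {x₀ : M} {b₀ : B}
    {y : E} (hy : y ∈ (extChartAt I x₀).target) {p : M} (hp : (extChartAt I x₀).symm y = p)
    (hb : π p ∈ (extChartAt J b₀).source) (v : E) :
    fderivWithin ℝ (fun z => extChartAt J b₀ (π ((extChartAt I x₀).symm z))) (range I) y v =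
      mfderiv J 𝓘(ℝ, E') (extChartAt J b₀) (π p) (mfderiv I J π p
        (mfderivWithin 𝓘(ℝ, E) I (extChartAt I x₀).symm (range I) y v)) := by
  subst hp
  have hU : UniqueMDiffWithinAt 𝓘(ℝ, E) (range I) y :=
    I.uniqueMDiffOn _ (extChartAt_target_subset_range x₀ hy)
  have h1 : MDifferentiableAt J 𝓘(ℝ, E') (extChartAt J b₀) (π ((extChartAt I x₀).symm y)) :=
    mdifferentiableAt_extChartAt (by rwa [← extChartAt_source J])
  have h2 : MDifferentiableAt I J π ((extChartAt I x₀).symm y) :=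
    (hπ.mdifferentiable (by simp)) _
  have h3 := mdifferentiableWithinAt_extChartAt_symm hy
  rw [← mfderivWithin_eq_fderivWithin]
  have e1 := mfderiv_comp_mfderivWithin (I := 𝓘(ℝ, E)) (I' := J) (I'' := 𝓘(ℝ, E')) y
    (g := extChartAt J b₀) (f := fun z => π ((extChartAt I x₀).symm z)) (s := range I) h1
    (h2.comp_mdifferentiableWithinAt y h3) hU
  have e2 := mfderiv_comp_mfderivWithin (I := 𝓘(ℝ, E)) (I' := I) (I'' := J) y
    (g := π) (f := (extChartAt I x₀).symm) (s := range I) h2 h3 hU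
  exact (DFunLike.congr_fun e1 v).trans (congrArg
    (mfderiv J 𝓘(ℝ, E') (extChartAt J b₀) (π ((extChartAt I x₀).symm y)))
    (DFunLike.congr_fun e2 v))

/-- The coordinate representation of a pullback. -/
theorem formInChart_pullbackForm {π : M → B} (hπ : ContMDiff I J ∞ π) (q : DiffForm J B F k)
    {x₀ : M} {b₀ : B} {y : E} (hy : y ∈ (extChartAt I x₀).target)
    (hb : π ((extChartAt I x₀).symm y) ∈ (extChartAt J b₀).source) :
    formInChart (pullbackForm (I := I) π q) x₀ y =
      (formInChart q b₀ (extChartAt J b₀ (π ((extChartAt I x₀).symm y)))).compContinuousLinearMap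
        (fderivWithin ℝ (fun z => extChartAt J b₀ (π ((extChartAt I x₀).symm z))) (range I) y) := by
  ext v
  refine form_apply_congr (E' := E') q ((extChartAt J b₀).left_inv hb).symm (funext fun i => ?_)
  have h := DFunLike.congr_fun (mfderivWithin_extChartAt_symm_comp_mfderiv_extChartAt' hb)
    (mfderiv I J π ((extChartAt I x₀).symm y)
        (mfderivWithin 𝓘(ℝ, E) I (extChartAt I x₀).symm (range I) y (v i)))
  refine h.symm.trans ?_
  exact congrArg (mfderivWithin 𝓘(ℝ, E') J (extChartAt J b₀).symm (range J) _)
    (hπ.fderivWithin_inCharts hy rfl hb (v i)).symm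

omit [IsManifold I ∞ M] in
theorem contDiffWithinAt_range_iff_target {G : Type*} [NormedAddCommGroup G] [NormedSpace ℝ G]
    {f : E → G} {x₀ : M} {y : E} (hy : y ∈ (extChartAt I x₀).target) :
    ContDiffWithinAt ℝ ∞ f (range I) y ↔ ContDiffWithinAt ℝ ∞ f (extChartAt I x₀).target y :=
  (contDiffWithinAt_congr_set (extChartAt_target_eventuallyEq_of_mem hy)).symm

omit [IsManifold I ∞ M] in
theorem isSmoothForm_iff {α : DiffForm I M F k} : IsSmoothForm α ↔
    ∀ (x₀ : M), ∀ y ∈ (extChartAt I x₀).target,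
      ContDiffWithinAt ℝ ∞ (formInChart α x₀) (range I) y :=
  forall_congr' fun _ => forall₂_congr fun _ hy => (contDiffWithinAt_range_iff_target hy).symm

omit [IsManifold I ∞ M] in
theorem mem_closure_interior_range {x₀ : M} {y : E} (hy : y ∈ (extChartAt I x₀).target) :
    y ∈ closure (interior (range I)) :=
  I.range_subset_closure_interior (extChartAt_target_subset_range x₀ hy)

theorem extDerivWithin_formInChart_pullbackForm {π : M → B} (hπ : ContMDiff I J ∞ π)
    {q : DiffForm J B F k} (hq : IsSmoothForm q)
    {x₀ : M} {b₀ : B} {y : E} (hy : y ∈ (extChartAt I x₀).target)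
    (hb : π ((extChartAt I x₀).symm y) ∈ (extChartAt J b₀).source) :
    extDerivWithin (formInChart (pullbackForm (I := I) π q) x₀) (range I) y =
      (extDerivWithin (formInChart q b₀) (range J)
        (extChartAt J b₀ (π ((extChartAt I x₀).symm y)))).compContinuousLinearMap
        (fderivWithin ℝ (fun z => extChartAt J b₀ (π ((extChartAt I x₀).symm z))) (range I) y) := by
  have hyr := extChartAt_target_subset_range x₀ hy
  have hcont : ContinuousAt (fun z => π ((extChartAt I x₀).symm z)) y :=
    hπ.continuous.continuousAt.comp (continuousAt_extChartAt_symm'' hy)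
  have hev : ∀ᶠ z in 𝓝[range I] y, z ∈ (extChartAt I x₀).target ∧
      π ((extChartAt I x₀).symm z) ∈ (extChartAt J b₀).source :=
    Filter.Eventually.and (extChartAt_target_mem_nhdsWithin_of_mem hy) (nhdsWithin_le_nhds
      (hcont.eventually ((isOpen_extChartAt_source (I := J) b₀).mem_nhds hb)))
  rw [Filter.EventuallyEq.extDerivWithin_eq_of_mem
    (hev.mono fun z hz => formInChart_pullbackForm hπ q hz.1 hz.2) hyr]
  exact extDerivWithin_pullback
    ((isSmoothForm_iff.1 hq b₀ _ ((extChartAt J b₀).map_source hb)).differentiableWithinAt (by simp))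
    (hπ.contDiffWithinAt_inCharts hy hb) minSmoothness_two_le_infty I.uniqueDiffOn
    (mem_closure_interior_range hy) hyr
    (fun z _ => ⟨chartAt H' b₀ (π ((extChartAt I x₀).symm z)), rfl⟩)

omit [IsManifold I ∞ M] in
theorem pullbackForm_id (α : DiffForm I M F k) : pullbackForm (I := I) (J := I) id α = α := by
  funext x
  ext v
  simp [pullbackForm, mfderiv_id]

/-- The exterior derivative may be computed in any chart. -/
theorem formInChart_extDerivForm {α : DiffForm I M F k} (hα : IsSmoothForm α) {x₀ : M} {y : E}
    (hy : y ∈ (extChartAt I x₀).target) :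
    formInChart (extDerivForm α) x₀ y = extDerivWithin (formInChart α x₀) (range I) y := by
  have h := extDerivWithin_formInChart_pullbackForm (I := I) (J := I) (π := id) contMDiff_id hα
    (b₀ := (extChartAt I x₀).symm y) hy (mem_extChartAt_source _)
  rw [pullbackForm_id] at h
  rw [h]
  ext v
  refine congrArg (extDerivWithin (formInChart α ((extChartAt I x₀).symm y)) (range I) _)
    (funext fun i => ?_)
  have e := (contMDiff_id (I := I) (n := ∞) (M := M)).fderivWithin_inCharts (J := I) hy rfl
    (mem_extChartAt_source ((extChartAt I x₀).symm y)) (v i)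
  refine Eq.trans ?_ e.symm
  simp only [mfderiv_id]
  rfl

/-- The exterior derivative commutes with pullbacks. -/
theorem extDerivForm_pullbackForm {π : M → B} (hπ : ContMDiff I J ∞ π)
    {q : DiffForm J B F k} (hq : IsSmoothForm q) :
    extDerivForm (pullbackForm (I := I) π q) = pullbackForm π (extDerivForm q) := by
  funext x
  have hx : (extChartAt I x).symm (extChartAt I x x) = x :=
    (extChartAt I x).left_inv (mem_extChartAt_source x)
  have hb : π ((extChartAt I x).symm (extChartAt I x x)) ∈ (extChartAt J (π x)).source := by
    rw [hx]; exact mem_extChartAt_source _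
  rw [extDerivForm, extDerivWithin_formInChart_pullbackForm hπ hq (mem_extChartAt_target x) hb]
  ext v
  refine form_apply_congr (extDerivWithin (formInChart q (π x)) (range J))
    (congrArg (fun z => extChartAt J (π x) (π z)) hx) (funext fun i => ?_)
  refine (hπ.fderivWithin_inCharts (mem_extChartAt_target x) hx (mem_extChartAt_source _) _).trans ?_
  have h := DFunLike.congr_fun (mfderivWithin_extChartAt_symm_comp_mfderiv_extChartAt'
    (mem_extChartAt_source (I := I) x)) (v i)
  exact congrArg (fun z => mfderiv J 𝓘(ℝ, E') (extChartAt J (π x)) (π x) (mfderiv I J π x z)) h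

theorem IsSmoothForm.extDerivForm {α : DiffForm I M F k} (hα : IsSmoothForm α) :
    IsSmoothForm (extDerivForm α) := by
  refine isSmoothForm_iff.2 fun x₀ y hy => ?_
  have hyr := extChartAt_target_subset_range x₀ hy
  have h : ContDiffWithinAt ℝ ∞ (extDerivWithin (formInChart α x₀) (range I)) (range I) y :=
    (ContinuousAlternatingMap.alternatizeUncurryFinCLM ℝ E F).contDiff.comp_contDiffWithinAt
      ((isSmoothForm_iff.1 hα x₀ y hy).fderivWithin_right I.uniqueDiffOn (by simp) hyr)
  refine h.congr_of_eventuallyEq ?_ (formInChart_extDerivForm hα hy)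
  filter_upwards [extChartAt_target_mem_nhdsWithin_of_mem hy] with z hz
  exact formInChart_extDerivForm hα hz

end Charts

/-! ### Linear operations on differential forms -/

section Linear

variable {E : Type*} [NormedAddCommGroup E] [NormedSpace ℝ E]
  {H : Type*} [TopologicalSpace H] {I : ModelWithCorners ℝ E H}
  {M : Type*} [TopologicalSpace M] [ChartedSpace H M]
  {F : Type*} [NormedAddCommGroup F] [NormedSpace ℝ F] {k : ℕ}

theorem IsSmoothForm.add {α β : DiffForm I M F k} (hα : IsSmoothForm α) (hβ : IsSmoothForm β) :
    IsSmoothForm (α + β) := fun x₀ => (hα x₀).add (hβ x₀)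

theorem IsSmoothForm.smul (c : ℝ) {α : DiffForm I M F k} (hα : IsSmoothForm α) :
    IsSmoothForm (c • α) := fun x₀ => (hα x₀).const_smul c

theorem IsSmoothForm.sub {α β : DiffForm I M F k} (hα : IsSmoothForm α) (hβ : IsSmoothForm β) :
    IsSmoothForm (α - β) := by
  have h := hα.add (hβ.smul (-1))
  rwa [neg_one_smul, ← sub_eq_add_neg] at h

theorem isSmoothForm_zero : IsSmoothForm (0 : DiffForm I M F k) := fun _ =>
  (contDiffOn_const (c := 0) : ContDiffOn ℝ ∞ (fun _ => (0 : E [⋀^Fin k]→L[ℝ] F)) _)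

theorem IsSmoothForm.sum {ι : Type*} (s : Finset ι) {α : ι → DiffForm I M F k}
    (hα : ∀ i, IsSmoothForm (α i)) : IsSmoothForm (∑ i ∈ s, α i) := by
  classical
  induction s using Finset.induction_on with
  | empty => simpa using isSmoothForm_zero
  | insert i s hi ih => rw [Finset.sum_insert hi]; exact (hα i).add ih

theorem IsSmoothForm.contDiffWithinAt {α : DiffForm I M F k} (hα : IsSmoothForm α) (x₀ : M) :
    ContDiffWithinAt ℝ ∞ (formInChart α x₀) (range I) (extChartAt I x₀ x₀) :=
  isSmoothForm_iff.1 hα x₀ _ (mem_extChartAt_target x₀)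

theorem uniqueDiffWithinAt_extChartAt (x : M) :
    UniqueDiffWithinAt ℝ (range I) (extChartAt I x x) :=
  I.uniqueDiffOn _ (mem_range_self _)

theorem extDerivForm_add {α β : DiffForm I M F k} (hα : IsSmoothForm α) (hβ : IsSmoothForm β) :
    extDerivForm (α + β) = extDerivForm α + extDerivForm β := by
  funext x
  exact congrArg (fun χ : E [⋀^Fin (k + 1)]→L[ℝ] F => χ.compContinuousLinearMap
    (show E →L[ℝ] E from mfderiv I 𝓘(ℝ, E) (extChartAt I x) x))
    (extDerivWithin_add (uniqueDiffWithinAt_extChartAt x)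
    ((hα.contDiffWithinAt x).differentiableWithinAt (by simp))
    ((hβ.contDiffWithinAt x).differentiableWithinAt (by simp)))

theorem extDerivForm_smul (c : ℝ) (α : DiffForm I M F k) :
    extDerivForm (c • α) = c • extDerivForm α := by
  funext x
  exact congrArg (fun χ : E [⋀^Fin (k + 1)]→L[ℝ] F => χ.compContinuousLinearMap
    (show E →L[ℝ] E from mfderiv I 𝓘(ℝ, E) (extChartAt I x) x))
    (extDerivWithin_smul c (formInChart α x) (uniqueDiffWithinAt_extChartAt x))

theorem extDerivForm_zero : extDerivForm (0 : DiffForm I M F k) = 0 := by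
  have h := extDerivForm_smul 0 (0 : DiffForm I M F k)
  rwa [zero_smul, zero_smul] at h

theorem extDerivForm_sum {ι : Type*} (s : Finset ι) {α : ι → DiffForm I M F k}
    (hα : ∀ i, IsSmoothForm (α i)) :
    extDerivForm (∑ i ∈ s, α i) = ∑ i ∈ s, extDerivForm (α i) := by
  classical
  induction s using Finset.induction_on with
  | empty => simpa using extDerivForm_zero
  | insert i s hi ih =>
    rw [Finset.sum_insert hi, Finset.sum_insert hi, extDerivForm_add (hα i) (IsSmoothForm.sum s hα),
      ih]

/-- At the centre of a chart, a form is recovered from its coordinate representation. -/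
theorem formInChart_comp_mfderiv [IsManifold I ∞ M] (α : DiffForm I M F k) (x : M) :
    (formInChart α x (extChartAt I x x)).compContinuousLinearMap
      (mfderiv I 𝓘(ℝ, E) (extChartAt I x) x) = α x := by
  ext v
  refine form_apply_congr (E' := E) α ((extChartAt I x).left_inv (mem_extChartAt_source x))
    (funext fun i => ?_)
  exact DFunLike.congr_fun (mfderivWithin_extChartAt_symm_comp_mfderiv_extChartAt'
    (mem_extChartAt_source (I := I) x)) (v i)

end Linear

/-! ### Brackets and curvature -/

section Curvature

theorem ContinuousAlternatingMap.ext_two {V N : Type*} [AddCommGroup V] [Module ℝ V]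
    [TopologicalSpace V] [AddCommGroup N] [Module ℝ N] [TopologicalSpace N]
    {α β : V [⋀^Fin 2]→L[ℝ] N} (h : ∀ u v, α ![u, v] = β ![u, v]) : α = β := by
  ext v
  have hv : v = ![v 0, v 1] := by funext i; fin_cases i <;> rfl
  rw [hv, h]

variable {E : Type*} [NormedAddCommGroup E] [NormedSpace ℝ E]
  {H : Type*} [TopologicalSpace H] {I : ModelWithCorners ℝ E H}
  {M : Type*} [TopologicalSpace M] [ChartedSpace H M]
  {𝔤 : Type*} [NormedLieRing 𝔤] [NormedLieAlgebra 𝔤] [FiniteDimensional ℝ 𝔤]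

theorem formBracket_apply (P Q : DiffForm I M 𝔤 1) (x : M) (u v : TangentSpace I x) :
    formBracket P Q x ![u, v] = ⁅P x ![u], Q x ![v]⁆ - ⁅P x ![v], Q x ![u]⁆ := by
  have hu : (Finset.univ : Finset (Equiv.Perm (Fin 2))) = {1, Equiv.swap 0 1} := by decide
  have h1 : (1 : Equiv.Perm (Fin 2)) ≠ Equiv.swap 0 1 := by decide
  have hblock : ∀ w : Fin 2 → TangentSpace I x, blockComp (lieBracketMultilinear 𝔤)
      ![⟨1, P x⟩, ⟨1, Q x⟩] (by simp [Fin.sum_univ_two]) w = ⁅P x ![w 0], Q x ![w 1]⁆ := by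
    intro w
    refine congrArg₂ (fun a b : 𝔤 => ⁅a, b⁆) (congrArg (P x) (funext fun j : Fin 1 => ?_))
      (congrArg (Q x) (funext fun j : Fin 1 => ?_))
    · fin_cases j
      refine congrArg w (Fin.ext ?_)
      simp [finSigmaFinEquiv_apply]
    · fin_cases j
      refine congrArg w (Fin.ext ?_)
      rfl
  rw [formBracket, wedgeEval, ContinuousAlternatingMap.smul_apply,
    ContinuousMultilinearMap.alternatization_apply_apply, hu, Finset.sum_pair h1, hblock, hblock]
  simp [sub_eq_add_neg]

theorem curvature_apply (A : DiffForm I M 𝔤 1) (x : M) (u v : TangentSpace I x) :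
    curvature A x ![u, v] = extDerivForm A x ![u, v] + ⁅A x ![u], A x ![v]⁆ := by
  change extDerivForm A x ![u, v] + (1 / 2 : ℝ) • formBracket A A x ![u, v] = _
  rw [formBracket_apply, ← lie_skew (A x ![u]) (A x ![v])]
  module

/-- The covariant exterior derivative `d_A b = db + [A, b]`. -/
noncomputable def covDeriv (A b : DiffForm I M 𝔤 1) : DiffForm I M 𝔤 2 :=
  extDerivForm b + formBracket A b

theorem covDeriv_apply (A b : DiffForm I M 𝔤 1) (x : M) (u v : TangentSpace I x) :
    covDeriv A b x ![u, v] =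
      extDerivForm b x ![u, v] + (⁅A x ![u], b x ![v]⁆ - ⁅A x ![v], b x ![u]⁆) := by
  rw [← formBracket_apply]
  rfl

theorem covDeriv_add_smul (A a b : DiffForm I M 𝔤 1) (t : ℝ) :
    covDeriv (A + t • a) b = covDeriv A b + t • formBracket a b := by
  funext x
  refine ContinuousAlternatingMap.ext_two fun u v => ?_
  change _ = covDeriv A b x ![u, v] + t • formBracket a b x ![u, v]
  rw [covDeriv_apply, covDeriv_apply, formBracket_apply]
  change _ + (⁅A x ![u] + t • a x ![u], _⁆ - ⁅A x ![v] + t • a x ![v], _⁆) = _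
  simp only [add_lie, smul_lie]
  module

theorem curvature_add_smul {A b : DiffForm I M 𝔤 1} (hA : IsSmoothForm A) (hb : IsSmoothForm b)
    (r : ℝ) : curvature (A + r • b) =
      curvature A + r • covDeriv A b + r ^ 2 • (1 / 2 : ℝ) • formBracket b b := by
  funext x
  refine ContinuousAlternatingMap.ext_two fun u v => ?_
  change _ = curvature A x ![u, v] + r • covDeriv A b x ![u, v] +
    r ^ 2 • (1 / 2 : ℝ) • formBracket b b x ![u, v]
  rw [curvature_apply, curvature_apply, covDeriv_apply, formBracket_apply,
    extDerivForm_add hA (hb.smul r), extDerivForm_smul]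
  change extDerivForm A x ![u, v] + r • extDerivForm b x ![u, v] +
    ⁅A x ![u] + r • b x ![u], A x ![v] + r • b x ![v]⁆ = _
  rw [← lie_skew (b x ![u]) (b x ![v]), ← lie_skew (A x ![v]) (b x ![u])]
  simp only [add_lie, lie_add, smul_lie, lie_smul]
  rw [← lie_skew (b x ![u]) (b x ![v])]
  module

theorem IsSmoothForm.formBracket [FiniteDimensional ℝ E] {P Q : DiffForm I M 𝔤 1}
    (hP : IsSmoothForm P) (hQ : IsSmoothForm Q) : IsSmoothForm (formBracket P Q) := by
  refine isSmoothForm_iff.2 fun x₀ y hy => contDiffWithinAt_of_eval fun v => ?_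
  have hP' := isSmoothForm_iff.1 hP x₀ y hy
  have hQ' := isSmoothForm_iff.1 hQ x₀ y hy
  have h : ∀ z, formInChart (_root_.formBracket P Q) x₀ z v =
      lieBracketCLM 𝔤 (formInChart P x₀ z ![v 0]) (formInChart Q x₀ z ![v 1]) -
        lieBracketCLM 𝔤 (formInChart P x₀ z ![v 1]) (formInChart Q x₀ z ![v 0]) := by
    intro z
    let T : E → TangentSpace I ((extChartAt I x₀).symm z) :=
      mfderivWithin 𝓘(ℝ, E) I (extChartAt I x₀).symm (range I) z
    have hT1 : ∀ u : E, (fun i => T (![u] i)) = ![T u] := fun u => by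
      funext i; fin_cases i; rfl
    have hT2 : (fun i => T (v i)) = ![T (v 0), T (v 1)] := by
      funext i; fin_cases i <;> rfl
    have h1 : formInChart (_root_.formBracket P Q) x₀ z v =
        _root_.formBracket P Q ((extChartAt I x₀).symm z) ![T (v 0), T (v 1)] := by
      rw [← hT2]; rfl
    rw [h1, formBracket_apply]
    simp only [← hT1]
    rfl
  simp only [h]
  exact (((lieBracketCLM 𝔤).contDiff.comp_contDiffWithinAt (hP'.eval_form _)).clm_apply
    (hQ'.eval_form _)).sub (((lieBracketCLM 𝔤).contDiff.comp_contDiffWithinAt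
      (hP'.eval_form _)).clm_apply (hQ'.eval_form _))

theorem IsSmoothForm.curvature [FiniteDimensional ℝ E] [IsManifold I ∞ M] {A : DiffForm I M 𝔤 1}
    (hA : IsSmoothForm A) : IsSmoothForm (curvature A) :=
  hA.extDerivForm.add ((hA.formBracket hA).smul _)

theorem IsSmoothForm.covDeriv [FiniteDimensional ℝ E] [IsManifold I ∞ M] {A b : DiffForm I M 𝔤 1}
    (hA : IsSmoothForm A) (hb : IsSmoothForm b) : IsSmoothForm (covDeriv A b) :=
  hb.extDerivForm.add (hA.formBracket hb)

end Curvature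

/-! ### Multilinearity and naturality of `⟨θ F₁ ⋯ Fₙ⟩` and `⟨θ η F₁ ⋯ Fₘ⟩` -/

section Multilinear

variable {V V' : Type*} [AddCommGroup V] [Module ℝ V] [TopologicalSpace V]
  [AddCommGroup V'] [Module ℝ V'] [TopologicalSpace V']
  {N : Type*} [AddCommGroup N] [Module ℝ N] [TopologicalSpace N]
  {W : Type*} [AddCommGroup W] [Module ℝ W] [TopologicalSpace W]
  [IsTopologicalAddGroup W] [ContinuousConstSMul ℝ W] {m n : ℕ}

theorem comp_vec_one {α β : Type*} (g : α → β) (u : α) : g ∘ ![u] = ![g u] := by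
  funext i; fin_cases i; rfl

theorem comp_vec_two {α β : Type*} (g : α → β) (u v : α) : g ∘ ![u, v] = ![g u, g v] := by
  funext i; fin_cases i <;> rfl

theorem oneOneTwo_compContinuousLinearMap
    (L : ContinuousMultilinearMap ℝ (fun _ : Fin (m + 2) => N) W)
    (θ η : V [⋀^Fin 1]→L[ℝ] N) (F : Fin m → V [⋀^Fin 2]→L[ℝ] N) (g : V' →L[ℝ] V) :
    (oneOneTwo L θ η F).compContinuousLinearMap g =
      oneOneTwo L (θ.compContinuousLinearMap g) (η.compContinuousLinearMap g)
        fun i => (F i).compContinuousLinearMap g := by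
  ext v
  simp only [ContinuousAlternatingMap.compContinuousLinearMap_apply, oneOneTwo_apply, permSum,
    comp_vec_one, comp_vec_two]
  rfl

theorem oneTwo_compContinuousLinearMap
    (L : ContinuousMultilinearMap ℝ (fun _ : Fin (n + 1) => N) W)
    (θ : V [⋀^Fin 1]→L[ℝ] N) (F : Fin n → V [⋀^Fin 2]→L[ℝ] N) (g : V' →L[ℝ] V) :
    (oneTwo L θ F).compContinuousLinearMap g =
      oneTwo L (θ.compContinuousLinearMap g) fun i => (F i).compContinuousLinearMap g := by
  ext v
  simp only [ContinuousAlternatingMap.compContinuousLinearMap_apply, oneTwo_apply, permSum,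
    comp_vec_one, comp_vec_two]
  rfl

omit [IsTopologicalAddGroup W] [ContinuousConstSMul ℝ W] in
theorem map_cons_cons_sum_smul (L : ContinuousMultilinearMap ℝ (fun _ : Fin (m + 2) => N) W)
    {K : Type*} [Fintype K] (x y : N) (c : K → ℝ) (Φ : K → Fin m → N) :
    L (Fin.cons x (Fin.cons y fun i => ∑ k, c k • Φ k i)) =
      ∑ r : Fin m → K, (∏ i, c (r i)) • L (Fin.cons x (Fin.cons y fun i => Φ (r i) i)) := by
  classical
  have h := ((L.toMultilinearMap.curryLeft x).curryLeft y).map_sum fun i k => c k • Φ k i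
  refine h.trans (Fintype.sum_congr _ _ fun r => ?_)
  exact ((L.toMultilinearMap.curryLeft x).curryLeft y).map_smul_univ (fun i => c (r i))
    fun i => Φ (r i) i

theorem oneOneTwo_sum_smul (L : ContinuousMultilinearMap ℝ (fun _ : Fin (m + 2) => N) W)
    [IsTopologicalAddGroup N] [ContinuousConstSMul ℝ N]
    {K : Type*} [Fintype K] (θ η : V [⋀^Fin 1]→L[ℝ] N) (c : K → ℝ)
    (G : K → V [⋀^Fin 2]→L[ℝ] N) :
    oneOneTwo L θ η (fun _ => ∑ k, c k • G k) =
      ∑ r : Fin m → K, (∏ i, c (r i)) • oneOneTwo L θ η fun i => G (r i) := by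
  ext v
  simp only [oneOneTwo_apply, ContinuousAlternatingMap.sum_apply,
    ContinuousAlternatingMap.smul_apply, map_cons_cons_sum_smul, permSum_sum, permSum_smul,
    Finset.smul_sum]
  exact Fintype.sum_congr _ _ fun r => smul_comm _ _ _

end Multilinear

/-! ### The form `⟨θ η F₁ ⋯ Fₘ⟩` on a manifold -/

section Forms

variable {E : Type*} [NormedAddCommGroup E] [NormedSpace ℝ E]
  {H : Type*} [TopologicalSpace H] {I : ModelWithCorners ℝ E H}
  {M : Type*} [TopologicalSpace M] [ChartedSpace H M]
  {𝔤 : Type*} [NormedLieRing 𝔤] [NormedLieAlgebra 𝔤]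
  {W : Type*} [NormedAddCommGroup W] [NormedSpace ℝ W] {m : ℕ}

theorem formInChart_apply_one {G : Type*} [NormedAddCommGroup G] [NormedSpace ℝ G]
    (α : DiffForm I M G 1) (x₀ : M) (y u : E) :
    formInChart α x₀ y ![u] = α ((extChartAt I x₀).symm y)
      ![mfderivWithin 𝓘(ℝ, E) I (extChartAt I x₀).symm (range I) y u] :=
  congrArg (α ((extChartAt I x₀).symm y))
    (comp_vec_one (mfderivWithin 𝓘(ℝ, E) I (extChartAt I x₀).symm (range I) y) u)

theorem formInChart_apply_two {G : Type*} [NormedAddCommGroup G] [NormedSpace ℝ G]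
    (α : DiffForm I M G 2) (x₀ : M) (y u v : E) :
    formInChart α x₀ y ![u, v] = α ((extChartAt I x₀).symm y)
      ![mfderivWithin 𝓘(ℝ, E) I (extChartAt I x₀).symm (range I) y u,
        mfderivWithin 𝓘(ℝ, E) I (extChartAt I x₀).symm (range I) y v] :=
  congrArg (α ((extChartAt I x₀).symm y))
    (comp_vec_two (mfderivWithin 𝓘(ℝ, E) I (extChartAt I x₀).symm (range I) y) u v)

/-- The form `⟨θ η F₁ ⋯ Fₘ⟩` for one-forms `θ`, `η` and two-forms `Fᵢ` on a manifold. -/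
noncomputable def oneOneTwoForm (L : ContinuousMultilinearMap ℝ (fun _ : Fin (m + 2) => 𝔤) W)
    (θ η : DiffForm I M 𝔤 1) (F : Fin m → DiffForm I M 𝔤 2) : DiffForm I M W (2 * (m + 1)) :=
  fun x => oneOneTwo L (θ x) (η x) fun i => F i x

theorem formInChart_oneOneTwoForm (L : ContinuousMultilinearMap ℝ (fun _ : Fin (m + 2) => 𝔤) W)
    (θ η : DiffForm I M 𝔤 1) (F : Fin m → DiffForm I M 𝔤 2) (x₀ : M) :
    formInChart (oneOneTwoForm L θ η F) x₀ = fun y =>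
      oneOneTwo L (formInChart θ x₀ y) (formInChart η x₀ y) fun i => formInChart (F i) x₀ y := by
  funext y
  exact oneOneTwo_compContinuousLinearMap L _ _ _ _

theorem IsSmoothForm.oneOneTwoForm [FiniteDimensional ℝ E] [FiniteDimensional ℝ W]
    (L : ContinuousMultilinearMap ℝ (fun _ : Fin (m + 2) => 𝔤) W)
    {θ η : DiffForm I M 𝔤 1} {F : Fin m → DiffForm I M 𝔤 2} (hθ : IsSmoothForm θ)
    (hη : IsSmoothForm η) (hF : ∀ i, IsSmoothForm (F i)) :
    IsSmoothForm (oneOneTwoForm L θ η F) := by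
  refine isSmoothForm_iff.2 fun x₀ y hy => ?_
  rw [formInChart_oneOneTwoForm]
  exact ContDiffWithinAt.oneOneTwo L (isSmoothForm_iff.1 hθ x₀ y hy)
    (isSmoothForm_iff.1 hη x₀ y hy) fun i => isSmoothForm_iff.1 (hF i) x₀ y hy

/-- The triangle equation before integration. -/
theorem IsInvariantPolynomial.extDerivForm_polyTwo [FiniteDimensional ℝ E] [FiniteDimensional ℝ W]
    [FiniteDimensional ℝ 𝔤] [IsManifold I ∞ M]
    {L : ContinuousMultilinearMap ℝ (fun _ : Fin (m + 2) => 𝔤) W} (hL : IsInvariantPolynomial L)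
    {A a b : DiffForm I M 𝔤 1} (hA : IsSmoothForm A) (ha : IsSmoothForm a) (hb : IsSmoothForm b)
    (x : M) :
    ((m : ℝ) + 1) • extDerivForm (polyTwo L b a (curvature A)) x =
      ∑ j, oneTwo L (a x) (Function.update (fun _ => curvature A x) j (covDeriv A b x)) -
        ∑ j, oneTwo L (b x) (Function.update (fun _ => curvature A x) j (covDeriv A a x)) := by
  have hcov : ∀ {c : DiffForm I M 𝔤 1} (hc : IsSmoothForm c) (u v : E),
      formInChart (covDeriv A c) x (extChartAt I x x) ![u, v] =
        extDerivWithin (formInChart c x) (range I) (extChartAt I x x) ![u, v] +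
          (⁅formInChart A x (extChartAt I x x) ![u], formInChart c x (extChartAt I x x) ![v]⁆ -
            ⁅formInChart A x (extChartAt I x x) ![v], formInChart c x (extChartAt I x x) ![u]⁆) := by
    intro c hc u v
    rw [← formInChart_extDerivForm hc (mem_extChartAt_target x)]
    refine (formInChart_apply_two (covDeriv A c) x _ u v).trans ((covDeriv_apply A c _ _ _).trans
      (congrArg₂ (· + ·) (formInChart_apply_two (extDerivForm c) x _ u v).symm ?_))
    simp only [formInChart_apply_one]
  have key := hL.extDerivWithin_oneOneTwo (s := range I) (x := extChartAt I x x)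
    (A := formInChart A x) (a := formInChart a x) (b := formInChart b x)
    (F := formInChart (curvature A) x) I.uniqueDiffOn (mem_range_self _)
    (mem_closure_interior_range (mem_extChartAt_target x)) (hA.contDiffWithinAt x)
    (ha.contDiffWithinAt x) (hb.contDiffWithinAt x) (hA.curvature.contDiffWithinAt x)
    (by
      filter_upwards [extChartAt_target_mem_nhdsWithin x] with y hy u v
      rw [← formInChart_extDerivForm hA hy]
      refine (formInChart_apply_two (curvature A) x _ u v).trans ((curvature_apply A _ _ _).trans
        (congrArg₂ (· + ·) (formInChart_apply_two (extDerivForm A) x _ u v).symm ?_))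
      simp only [formInChart_apply_one])
    (hcov ha) (hcov hb)
  have hback : ∀ (c : DiffForm I M 𝔤 1) (d : DiffForm I M 𝔤 2) (j : Fin (m + 1)),
      (oneTwo L (formInChart c x (extChartAt I x x)) (Function.update
        (fun _ => formInChart (curvature A) x (extChartAt I x x)) j
          (formInChart d x (extChartAt I x x)))).compContinuousLinearMap
            (mfderiv I 𝓘(ℝ, E) (extChartAt I x) x) =
      oneTwo L (c x) (Function.update (fun _ => curvature A x) j (d x)) := by
    intro c d j
    refine (oneTwo_compContinuousLinearMap L _ _ _).trans ?_
    refine congrArg₂ (oneTwo L) (formInChart_comp_mfderiv c x) (funext fun i => ?_)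
    rcases eq_or_ne i j with rfl | hij
    · rw [Function.update_self, Function.update_self]
      exact formInChart_comp_mfderiv d x
    · rw [Function.update_of_ne hij, Function.update_of_ne hij]
      exact formInChart_comp_mfderiv (curvature A) x
  ext v
  let w : Fin (2 * (m + 1) + 1) → E := fun i => mfderiv I 𝓘(ℝ, E) (extChartAt I x) x (v i)
  have hv := DFunLike.congr_fun key w
  simp only [ContinuousAlternatingMap.smul_apply, ContinuousAlternatingMap.sub_apply,
    ContinuousAlternatingMap.sum_apply] at hv ⊢
  simp only [← hback]
  have hf : (fun y => oneOneTwo L (formInChart b x y) (formInChart a x y)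
      fun _ => formInChart (curvature A) x y) = formInChart (polyTwo L b a (curvature A)) x :=
    (formInChart_oneOneTwoForm L b a (fun _ => curvature A) x).symm
  rw [hf] at hv
  exact hv

end Forms

/-! ### Green's formula on the triangle `0 ≤ s ≤ t ≤ 1` -/

section Green

variable {W : Type*} [NormedAddCommGroup W] [NormedSpace ℝ W]

theorem integral_triangle_swap {h : ℝ → ℝ → W} (hc : Continuous (Function.uncurry h)) :
    ∫ t in (0 : ℝ)..1, ∫ s in (0 : ℝ)..t, h t s = ∫ s in (0 : ℝ)..1, ∫ t in s..1, h t s := by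
  have hT : MeasurableSet {p : ℝ × ℝ | p.2 ≤ p.1} := measurableSet_le measurable_snd measurable_fst
  have hint : Integrable (Function.uncurry fun t s => {p : ℝ × ℝ | p.2 ≤ p.1}.indicator
      (Function.uncurry h) (t, s))
      ((volume.restrict (Ioc (0 : ℝ) 1)).prod (volume.restrict (Ioc (0 : ℝ) 1))) := by
    rw [Measure.prod_restrict]
    refine Integrable.indicator (f := Function.uncurry h) ?_ hT
    have hK : IntegrableOn (Function.uncurry h) (Icc (0 : ℝ) 1 ×ˢ Icc (0 : ℝ) 1)
        (volume.prod volume) :=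
      hc.continuousOn.integrableOn_compact (isCompact_Icc.prod isCompact_Icc)
    exact hK.mono_set (prod_mono Ioc_subset_Icc_self Ioc_subset_Icc_self)
  have hswap := integral_integral_swap hint
  rw [intervalIntegral.integral_of_le zero_le_one, intervalIntegral.integral_of_le zero_le_one]
  refine Eq.trans (setIntegral_congr_fun measurableSet_Ioc fun t ht => ?_)
    (hswap.trans (setIntegral_congr_fun measurableSet_Ioc fun s hs => ?_))
  · have h1 : ∀ s, {p : ℝ × ℝ | p.2 ≤ p.1}.indicator (Function.uncurry h) (t, s) =
        (Iic t).indicator (h t) s := fun s => rfl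
    simp only [h1]
    rw [intervalIntegral.integral_of_le ht.1.le, setIntegral_indicator measurableSet_Iic,
      Ioc_inter_Iic, min_eq_right ht.2]
  · have h1 : ∀ t, {p : ℝ × ℝ | p.2 ≤ p.1}.indicator (Function.uncurry h) (t, s) =
        (Ici s).indicator (fun t => h t s) t := fun t => rfl
    simp only [h1]
    rw [intervalIntegral.integral_of_le hs.2, setIntegral_indicator measurableSet_Ici,
      ← integral_Icc_eq_integral_Ioc]
    refine congrArg (fun S => ∫ t in S, h t s) (Set.ext fun t => ?_)
    exact ⟨fun ht => ⟨ht.2, ht.1.2⟩, fun ht => ⟨⟨hs.1.trans_le ht.1, ht.2⟩, ht.1⟩⟩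

/-- Green's formula on the triangle `0 ≤ s ≤ t ≤ 1`. -/
theorem integral_triangle_sub [CompleteSpace W] {f g f' g' : ℝ → ℝ → W}
    (hf : ∀ t s, HasDerivAt (fun s => f t s) (f' t s) s)
    (hg : ∀ t s, HasDerivAt (fun t => g t s) (g' t s) t)
    (hfc : Continuous (Function.uncurry f)) (hgc : Continuous (Function.uncurry g))
    (hf' : Continuous (Function.uncurry f')) (hg' : Continuous (Function.uncurry g')) :
    ∫ t in (0 : ℝ)..1, ∫ s in (0 : ℝ)..t, (f' t s - g' t s) =
      (∫ t in (0 : ℝ)..1, (f t t + g t t)) -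
        (∫ t in (0 : ℝ)..1, g 1 t) - ∫ t in (0 : ℝ)..1, f t 0 := by
  have hfs : ∀ t, Continuous (f' t) := fun t => hf'.comp (Continuous.prodMk_right t)
  have hgs : ∀ t, Continuous (g' t) := fun t => hg'.comp (Continuous.prodMk_right t)
  have hgt : ∀ s, Continuous fun t => g' t s := fun s => hg'.comp (Continuous.prodMk_left s)
  have hftt : Continuous fun t => f t t := hfc.comp (continuous_id.prodMk continuous_id)
  have hgtt : Continuous fun t => g t t := hgc.comp (continuous_id.prodMk continuous_id)
  have hft0 : Continuous fun t => f t 0 := hfc.comp (Continuous.prodMk_left 0)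
  have hg1 : Continuous fun t => g 1 t := hgc.comp (Continuous.prodMk_right 1)
  have hF : ∀ t, ∫ s in (0 : ℝ)..t, f' t s = f t t - f t 0 := fun t =>
    intervalIntegral.integral_eq_sub_of_hasDerivAt (fun s _ => hf t s)
      ((hfs t).intervalIntegrable _ _)
  have hG : ∀ s, ∫ t in s..(1 : ℝ), g' t s = g 1 s - g s s := fun s =>
    intervalIntegral.integral_eq_sub_of_hasDerivAt (fun t _ => hg t s)
      ((hgt s).intervalIntegrable _ _)
  have hGc : Continuous fun t => ∫ s in (0 : ℝ)..t, g' t s :=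
    intervalIntegral.continuous_parametric_intervalIntegral_of_continuous hg' continuous_id
  have h1 : ∀ t, ∫ s in (0 : ℝ)..t, (f' t s - g' t s) =
      (f t t - f t 0) - ∫ s in (0 : ℝ)..t, g' t s := fun t => by
    rw [intervalIntegral.integral_sub ((hfs t).intervalIntegrable _ _)
      ((hgs t).intervalIntegrable _ _), hF]
  simp only [h1]
  rw [intervalIntegral.integral_sub (f := fun t => f t t - f t 0)
      ((hftt.sub hft0).intervalIntegrable _ _)
      (hGc.intervalIntegrable _ _), integral_triangle_swap hg']
  simp only [hG]
  rw [intervalIntegral.integral_sub (hftt.intervalIntegrable _ _) (hft0.intervalIntegrable _ _),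
    intervalIntegral.integral_sub (hg1.intervalIntegrable _ _) (hgtt.intervalIntegrable _ _),
    intervalIntegral.integral_add (hftt.intervalIntegrable _ _) (hgtt.intervalIntegrable _ _)]
  abel

end Green

/-! ### Families of forms depending on parameters -/

section Families

variable {V : Type*} [AddCommGroup V] [Module ℝ V] [TopologicalSpace V]
  {N : Type*} [NormedAddCommGroup N] [NormedSpace ℝ N]
  {W : Type*} [NormedAddCommGroup W] [NormedSpace ℝ W] {n : ℕ}

theorem continuous_oneTwo_apply {X : Type*} [TopologicalSpace X]
    (L : ContinuousMultilinearMap ℝ (fun _ : Fin (n + 1) => N) W) (θ : V [⋀^Fin 1]→L[ℝ] N)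
    {F : X → Fin n → V [⋀^Fin 2]→L[ℝ] N} (hF : ∀ i w, Continuous fun y => F y i w)
    (v : Fin (2 * n + 1) → V) : Continuous fun y => oneTwo L θ (F y) v := by
  simp only [oneTwo_apply, permSum]
  refine (continuous_finsetSum _ fun σ _ => Continuous.const_smul ?_ _).const_smul _
  exact L.cont.comp (continuous_pi fun i => Fin.cases continuous_const (fun i => hF i _) i)

theorem continuous_oneTwo_update_apply {X : Type*} [TopologicalSpace X]
    (L : ContinuousMultilinearMap ℝ (fun _ : Fin (n + 1) => N) W) (θ : V [⋀^Fin 1]→L[ℝ] N)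
    {F Z : X → V [⋀^Fin 2]→L[ℝ] N} (hF : ∀ w, Continuous fun y => F y w)
    (hZ : ∀ w, Continuous fun y => Z y w) (j : Fin n) (v : Fin (2 * n + 1) → V) :
    Continuous fun y => oneTwo L θ (Function.update (fun _ => F y) j (Z y)) v := by
  refine continuous_oneTwo_apply L θ (fun i w => ?_) v
  rcases eq_or_ne i j with rfl | hij
  · simpa only [Function.update_self] using hZ w
  · simpa only [Function.update_of_ne hij] using hF w

theorem hasDerivAt_map_cons (L : ContinuousMultilinearMap ℝ (fun _ : Fin (n + 1) => N) W)
    (p : N) {q : ℝ → Fin n → N} {q' : Fin n → N} {r : ℝ}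
    (hq : ∀ i, HasDerivAt (fun r => q r i) (q' i) r) :
    HasDerivAt (fun r => L (Fin.cons p (q r)))
      (∑ j, L (Fin.cons p (Function.update (q r) j (q' j)))) r := by
  let g : Fin (n + 1) → ℝ → N := Fin.cons (fun _ => p) fun i r => q r i
  let g' : Fin (n + 1) → N := Fin.cons 0 q'
  have hg : ∀ i, HasFDerivAt (g i) (ContinuousLinearMap.toSpanSingleton ℝ (g' i)) r := fun i =>
    Fin.cases (hasDerivAt_const r p).hasFDerivAt (fun i => (hq i).hasFDerivAt) i
  have hgy : ∀ y, (fun i => g i y) = (Fin.cons p (q y) : Fin (n + 1) → N) := fun y =>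
    funext fun i => Fin.cases rfl (fun i => rfl) i
  have h := (HasFDerivAt.multilinear_comp L hg).hasDerivAt
  simp only [hgy] at h
  convert h using 1
  have h0 : L (Fin.cons 0 (q r)) = 0 := L.map_coord_zero 0 rfl
  simp only [Fin.sum_univ_succ, g', add_apply, sum_apply, ContinuousLinearMap.coe_comp,
    Function.comp_apply, ContinuousMultilinearMap.toContinuousLinearMap_apply, ← Fin.cons_update]
  simp [h0]

theorem hasDerivAt_oneTwo_apply (L : ContinuousMultilinearMap ℝ (fun _ : Fin (n + 1) => N) W)
    (θ : V [⋀^Fin 1]→L[ℝ] N) {F : ℝ → V [⋀^Fin 2]→L[ℝ] N} {F' : V [⋀^Fin 2]→L[ℝ] N} {r : ℝ}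
    (hF : ∀ w, HasDerivAt (fun r => F r w) (F' w) r) (v : Fin (2 * n + 1) → V) :
    HasDerivAt (fun r => oneTwo L θ (fun _ => F r) v)
      (∑ j, oneTwo L θ (Function.update (fun _ => F r) j F') v) r := by
  simp only [oneTwo_apply]
  rw [← Finset.smul_sum, ← permSum_sum]
  refine HasDerivAt.const_smul _ (HasDerivAt.fun_sum fun σ _ => HasDerivAt.const_smul _ ?_)
  convert hasDerivAt_map_cons L (θ ![(v ∘ σ) 0]) (q := fun r i =>
    F r ![(v ∘ σ) ⟨2 * i + 1, by omega⟩, (v ∘ σ) ⟨2 * i + 2, by omega⟩]) (fun i => hF _) using 1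
  refine Fintype.sum_congr _ _ fun j => congrArg (fun z => L (Fin.cons _ z)) (funext fun i => ?_)
  rcases eq_or_ne i j with rfl | hij
  · simp
  · simp [Function.update_of_ne hij]

end Families

/-! ### The curvature on a two-parameter family of connections -/

section Triangle

variable {E : Type*} [NormedAddCommGroup E] [NormedSpace ℝ E]
  {H : Type*} [TopologicalSpace H] {I : ModelWithCorners ℝ E H}
  {M : Type*} [TopologicalSpace M] [ChartedSpace H M]
  {𝔤 : Type*} [NormedLieRing 𝔤] [NormedLieAlgebra 𝔤] [FiniteDimensional ℝ 𝔤]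
  {W : Type*} [NormedAddCommGroup W] [NormedSpace ℝ W]

/-- The monomials in `t`, `s` that occur in the curvature of `A + t • a + s • b`. -/
def curvatureMonomial (t s : ℝ) : Fin 6 → ℝ := ![1, t, t ^ 2, s, t * s, s ^ 2]

/-- The coefficients of the curvature of `A + t • a + s • b`, as a polynomial in `t`, `s`. -/
noncomputable def curvatureCoeff (A a b : DiffForm I M 𝔤 1) : Fin 6 → DiffForm I M 𝔤 2 :=
  ![curvature A, covDeriv A a, (1 / 2 : ℝ) • formBracket a a, covDeriv A b, formBracket a b,
    (1 / 2 : ℝ) • formBracket b b]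

theorem continuous_curvatureMonomial (k : Fin 6) :
    Continuous fun p : ℝ × ℝ => curvatureMonomial p.1 p.2 k := by
  fin_cases k <;> simp [curvatureMonomial] <;> fun_prop

theorem curvature_add_smul_add_smul {A a b : DiffForm I M 𝔤 1} (hA : IsSmoothForm A)
    (ha : IsSmoothForm a) (hb : IsSmoothForm b) (t s : ℝ) :
    curvature (A + t • a + s • b) = ∑ k, curvatureMonomial t s k • curvatureCoeff A a b k := by
  rw [curvature_add_smul (hA.add (ha.smul t)) hb, curvature_add_smul hA ha, covDeriv_add_smul]
  simp only [curvatureMonomial, curvatureCoeff, Fin.sum_univ_six, Matrix.cons_val]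
  module

theorem IsSmoothForm.curvatureCoeff [FiniteDimensional ℝ E] [IsManifold I ∞ M]
    {A a b : DiffForm I M 𝔤 1} (hA : IsSmoothForm A) (ha : IsSmoothForm a) (hb : IsSmoothForm b)
    (k : Fin 6) : IsSmoothForm (curvatureCoeff A a b k) := by
  fin_cases k
  · exact hA.curvature
  · exact hA.covDeriv ha
  · exact (ha.formBracket ha).smul _
  · exact hA.covDeriv hb
  · exact ha.formBracket hb
  · exact (hb.formBracket hb).smul _

theorem continuous_curvature_apply {A a b : DiffForm I M 𝔤 1} (hA : IsSmoothForm A)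
    (ha : IsSmoothForm a) (hb : IsSmoothForm b) (x : M) (w : Fin 2 → TangentSpace I x) :
    Continuous fun p : ℝ × ℝ => curvature (A + p.1 • a + p.2 • b) x w := by
  have h : ∀ p : ℝ × ℝ, curvature (A + p.1 • a + p.2 • b) x w =
      ∑ k, curvatureMonomial p.1 p.2 k • curvatureCoeff A a b k x w := fun p => by
    rw [curvature_add_smul_add_smul hA ha hb, Finset.sum_apply,
      ContinuousAlternatingMap.sum_apply]
    rfl
  simp only [h]
  exact continuous_finsetSum _ fun k _ => (continuous_curvatureMonomial k).smul continuous_const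

theorem continuous_covDeriv_apply (A a b c : DiffForm I M 𝔤 1) (x : M)
    (w : Fin 2 → TangentSpace I x) :
    Continuous fun p : ℝ × ℝ => covDeriv (A + p.1 • a + p.2 • b) c x w := by
  simp only [covDeriv_add_smul]
  change Continuous fun p : ℝ × ℝ => covDeriv A c x w + p.1 • formBracket a c x w +
    p.2 • formBracket b c x w
  fun_prop

theorem hasDerivAt_curvature_apply {A b : DiffForm I M 𝔤 1} (hA : IsSmoothForm A)
    (hb : IsSmoothForm b) (x : M) (w : Fin 2 → TangentSpace I x) (r : ℝ) :
    HasDerivAt (fun r => curvature (A + r • b) x w) (covDeriv (A + r • b) b x w) r := by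
  simp only [curvature_add_smul hA hb, covDeriv_add_smul]
  change HasDerivAt (fun r : ℝ => curvature A x w + r • covDeriv A b x w +
    r ^ 2 • (1 / 2 : ℝ) • formBracket b b x w) (covDeriv A b x w + r • formBracket b b x w) r
  have h := (((hasDerivAt_id r).smul_const (covDeriv A b x w)).const_add (curvature A x w)).add
    ((hasDerivAt_pow 2 r).smul_const ((1 / 2 : ℝ) • formBracket b b x w))
  refine h.congr_deriv ?_
  have h2 : ((2 : ℕ) : ℝ) * r ^ (2 - 1) * (1 / 2) = r := by norm_num; ring
  rw [smul_smul, one_smul, h2]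

omit [FiniteDimensional ℝ 𝔤] in
theorem polyTwo_sum_smul {m : ℕ}
    (L : ContinuousMultilinearMap ℝ (fun _ : Fin (m + 2) => 𝔤) W) (θ η : DiffForm I M 𝔤 1)
    {K : Type*} [Fintype K] (c : K → ℝ) (G : K → DiffForm I M 𝔤 2) :
    polyTwo L θ η (∑ k, c k • G k) =
      ∑ r : Fin m → K, (∏ i, c (r i)) • oneOneTwoForm L θ η fun i => G (r i) := by
  funext x
  refine Eq.trans ?_ ((oneOneTwo_sum_smul L (θ x) (η x) c fun k => G k x).trans ?_)
  · change oneOneTwo L (θ x) (η x) (fun _ => (∑ k, c k • G k) x) = _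
    rw [Finset.sum_apply]
    rfl
  · rw [Finset.sum_apply]
    rfl

theorem continuous_prod_curvatureMonomial {m : ℕ} (r : Fin m → Fin 6) :
    Continuous fun p : ℝ × ℝ => ∏ i, curvatureMonomial p.1 p.2 (r i) :=
  continuous_finsetProd _ fun i _ => continuous_curvatureMonomial (r i)

theorem integral_integral_sum_smul {G : Type*} [NormedAddCommGroup G] [NormedSpace ℝ G]
    [CompleteSpace G] {K : Type*} [Fintype K] {c : K → ℝ → ℝ → ℝ}
    (hc : ∀ r, Continuous (Function.uncurry (c r))) (g : K → G) :
    ∫ t in (0 : ℝ)..1, ∫ s in (0 : ℝ)..t, ∑ r, c r t s • g r =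
      ∑ r, (∫ t in (0 : ℝ)..1, ∫ s in (0 : ℝ)..t, c r t s) • g r := by
  have hct : ∀ r t, Continuous (c r t) := fun r t => (hc r).comp (Continuous.prodMk_right t)
  have hci : ∀ r, Continuous fun t => ∫ s in (0 : ℝ)..t, c r t s := fun r =>
    intervalIntegral.continuous_parametric_intervalIntegral_of_continuous (hc r) continuous_id
  have h1 : ∀ t, ∫ s in (0 : ℝ)..t, ∑ r, c r t s • g r =
      ∑ r, (∫ s in (0 : ℝ)..t, c r t s) • g r := fun t => by
    rw [intervalIntegral.integral_finsetSum (f := fun r s => c r t s • g r) fun r _ =>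
      ((hct r t).smul continuous_const).intervalIntegrable _ _]
    simp only [intervalIntegral.integral_smul_const]
  simp only [h1]
  rw [intervalIntegral.integral_finsetSum
    (f := fun r t => (∫ s in (0 : ℝ)..t, c r t s) • g r) fun r _ =>
    ((hci r).smul continuous_const).intervalIntegrable _ _]
  simp only [intervalIntegral.integral_smul_const]

theorem boundaryForm_succ [FiniteDimensional ℝ W] {m : ℕ}
    (L : ContinuousMultilinearMap ℝ (fun _ : Fin (m + 1 + 1) => 𝔤) W)
    {A₀ A₁ A₂ : DiffForm I M 𝔤 1} (hA₀ : IsSmoothForm A₀) (hA₁ : IsSmoothForm A₁)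
    (hA₂ : IsSmoothForm A₂) :
    boundaryForm L A₂ A₁ A₀ = (((m + 1 : ℕ) : ℝ) * (((m + 1 : ℕ) : ℝ) + 1)) •
      ∑ r : Fin m → Fin 6,
        (∫ t in (0 : ℝ)..1, ∫ s in (0 : ℝ)..t, ∏ i, curvatureMonomial t s (r i)) •
          oneOneTwoForm L (A₂ - A₁) (A₁ - A₀)
            fun i => curvatureCoeff A₀ (A₁ - A₀) (A₂ - A₁) (r i) := by
  refine congrArg (_ • ·) (funext fun x => ?_)
  have h := integral_integral_sum_smul (G := E [⋀^Fin (2 * (m + 1))]→L[ℝ] W)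
    (c := fun (r : Fin m → Fin 6) t s => ∏ i, curvatureMonomial t s (r i))
    continuous_prod_curvatureMonomial
    fun r => oneOneTwoForm L (A₂ - A₁) (A₁ - A₀)
      (fun i => curvatureCoeff A₀ (A₁ - A₀) (A₂ - A₁) (r i)) x
  rw [Finset.sum_apply]
  refine Eq.trans ?_ h
  simp only [curvature_add_smul_add_smul hA₀ (hA₁.sub hA₀) (hA₂.sub hA₁), polyTwo_sum_smul]
  simp only [integralForm, Finset.sum_apply]
  rfl

theorem IsSmoothForm.boundaryForm [FiniteDimensional ℝ E] [FiniteDimensional ℝ W]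
    [IsManifold I ∞ M] {n : ℕ}
    (L : ContinuousMultilinearMap ℝ (fun _ : Fin (n + 1) => 𝔤) W)
    {A₀ A₁ A₂ : DiffForm I M 𝔤 1} (hA₀ : IsSmoothForm A₀) (hA₁ : IsSmoothForm A₁)
    (hA₂ : IsSmoothForm A₂) : IsSmoothForm (boundaryForm L A₂ A₁ A₀) := by
  cases n with
  | zero => exact isSmoothForm_zero
  | succ m =>
    rw [boundaryForm_succ L hA₀ hA₁ hA₂]
    refine IsSmoothForm.smul _ (IsSmoothForm.sum _ fun r => IsSmoothForm.smul _ ?_)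
    exact IsSmoothForm.oneOneTwoForm L (hA₂.sub hA₁) (hA₁.sub hA₀)
      fun i => IsSmoothForm.curvatureCoeff hA₀ (hA₁.sub hA₀) (hA₂.sub hA₁) (r i)

/-- The exterior derivative commutes with the integral over the triangle. -/
theorem extDerivForm_boundaryForm_apply [FiniteDimensional ℝ E] [FiniteDimensional ℝ W]
    [IsManifold I ∞ M] {m : ℕ}
    (L : ContinuousMultilinearMap ℝ (fun _ : Fin (m + 1 + 1) => 𝔤) W)
    {A₀ A₁ A₂ : DiffForm I M 𝔤 1} (hA₀ : IsSmoothForm A₀) (hA₁ : IsSmoothForm A₁)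
    (hA₂ : IsSmoothForm A₂) (x : M) (v : Fin (2 * (m + 1) + 1) → TangentSpace I x) :
    extDerivForm (boundaryForm L A₂ A₁ A₀) x v = (((m + 1 : ℕ) : ℝ) * (((m + 1 : ℕ) : ℝ) + 1)) •
      ∫ t in (0 : ℝ)..1, ∫ s in (0 : ℝ)..t, extDerivForm (polyTwo L (A₂ - A₁) (A₁ - A₀)
        (curvature (A₀ + t • (A₁ - A₀) + s • (A₂ - A₁)))) x v := by
  have hs : ∀ r : Fin m → Fin 6, IsSmoothForm (oneOneTwoForm L (A₂ - A₁) (A₁ - A₀)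
      fun i => curvatureCoeff A₀ (A₁ - A₀) (A₂ - A₁) (r i)) := fun r =>
    IsSmoothForm.oneOneTwoForm L (hA₂.sub hA₁) (hA₁.sub hA₀) fun i =>
      IsSmoothForm.curvatureCoeff hA₀ (hA₁.sub hA₀) (hA₂.sub hA₁) (r i)
  have happ : ∀ c : (Fin m → Fin 6) → ℝ, extDerivForm (∑ r, c r • oneOneTwoForm L (A₂ - A₁)
      (A₁ - A₀) fun i => curvatureCoeff A₀ (A₁ - A₀) (A₂ - A₁) (r i)) x v =
      ∑ r, c r • extDerivForm (oneOneTwoForm L (A₂ - A₁) (A₁ - A₀)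
        fun i => curvatureCoeff A₀ (A₁ - A₀) (A₂ - A₁) (r i)) x v := fun c => by
    rw [extDerivForm_sum _ fun r => (hs r).smul (c r), Finset.sum_apply,
      ContinuousAlternatingMap.sum_apply]
    simp only [extDerivForm_smul]
    rfl
  simp only [curvature_add_smul_add_smul hA₀ (hA₁.sub hA₀) (hA₂.sub hA₁), polyTwo_sum_smul,
    happ]
  rw [boundaryForm_succ L hA₀ hA₁ hA₂, extDerivForm_smul]
  refine congrArg (((((m + 1 : ℕ) : ℝ) * (((m + 1 : ℕ) : ℝ) + 1))) • · : W → W) ((happ _).trans ?_)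
  have : CompleteSpace W := FiniteDimensional.complete ℝ W
  exact (integral_integral_sum_smul continuous_prod_curvatureMonomial _).symm

theorem transgression_apply [FiniteDimensional ℝ E] [FiniteDimensional ℝ W] {n : ℕ}
    (L : ContinuousMultilinearMap ℝ (fun _ : Fin (n + 1) => 𝔤) W)
    {A₀ A₁ : DiffForm I M 𝔤 1} (hA₀ : IsSmoothForm A₀) (hA₁ : IsSmoothForm A₁) (x : M)
    (v : Fin (2 * n + 1) → TangentSpace I x) :
    transgression L A₁ A₀ x v = ((n : ℝ) + 1) • ∫ t in (0 : ℝ)..1,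
      oneTwo L ((A₁ - A₀) x) (fun _ => curvature (A₀ + t • (A₁ - A₀)) x) v := by
  have hF : ∀ w : Fin 2 → TangentSpace I x,
      Continuous fun t : ℝ => curvature (A₀ + t • (A₁ - A₀)) x w := fun w => by
    have h := (continuous_curvature_apply hA₀ (hA₁.sub hA₀) isSmoothForm_zero x w).comp
      (Continuous.prodMk_left (0 : ℝ))
    simpa [Function.comp_def] using h
  have hc : Continuous fun t : ℝ => (show E [⋀^Fin (2 * n + 1)]→L[ℝ] W from
      oneTwo L ((A₁ - A₀) x) fun _ => curvature (A₀ + t • (A₁ - A₀)) x) :=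
    continuous_of_eval fun w => continuous_oneTwo_apply (V := TangentSpace I x) L _
      (fun _ => hF) w
  let ev : (E [⋀^Fin (2 * n + 1)]→L[ℝ] W) →L[ℝ] W :=
    ContinuousAlternatingMap.apply ℝ E W (show Fin (2 * n + 1) → E from v)
  refine congrArg (((n : ℝ) + 1) • · : W → W) ?_
  have : CompleteSpace W := FiniteDimensional.complete ℝ W
  exact (ev.intervalIntegral_comp_comm (hc.intervalIntegrable 0 1)).symm

end Triangle

/-! ### The triangle equation -/

section Main

theorem oneTwo_add_left {V : Type*} [AddCommGroup V] [Module ℝ V] [TopologicalSpace V]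
    {N : Type*} [AddCommGroup N] [Module ℝ N] [TopologicalSpace N] [IsTopologicalAddGroup N]
    {W : Type*} [AddCommGroup W] [Module ℝ W] [TopologicalSpace W] [IsTopologicalAddGroup W]
    [ContinuousConstSMul ℝ W] {n : ℕ} (L : ContinuousMultilinearMap ℝ (fun _ : Fin (n + 1) => N) W)
    (θ θ' : V [⋀^Fin 1]→L[ℝ] N) (F : Fin n → V [⋀^Fin 2]→L[ℝ] N) (v : Fin (2 * n + 1) → V) :
    oneTwo L (θ + θ') F v = oneTwo L θ F v + oneTwo L θ' F v := by
  simp only [oneTwo_apply, ContinuousAlternatingMap.add_apply, ContinuousMultilinearMap.cons_add,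
    permSum_add, smul_add]

variable {E : Type*} [NormedAddCommGroup E] [NormedSpace ℝ E] [FiniteDimensional ℝ E]
  {H : Type*} [TopologicalSpace H] {I : ModelWithCorners ℝ E H}
  {M : Type*} [TopologicalSpace M] [ChartedSpace H M] [IsManifold I ∞ M]
  {𝔤 : Type*} [NormedLieRing 𝔤] [NormedLieAlgebra 𝔤] [FiniteDimensional ℝ 𝔤]
  {W : Type*} [NormedAddCommGroup W] [NormedSpace ℝ W] [FiniteDimensional ℝ W]

omit [IsManifold I ∞ M] in
theorem transgression_eq_add_add_of_zero
    (L : ContinuousMultilinearMap ℝ (fun _ : Fin (0 + 1) => 𝔤) W)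
    {A₀ A₁ A₂ : DiffForm I M 𝔤 1} (hA₀ : IsSmoothForm A₀) (hA₁ : IsSmoothForm A₁)
    (hA₂ : IsSmoothForm A₂) :
    transgression L A₂ A₀ = transgression L A₂ A₁ + transgression L A₁ A₀ := by
  funext x
  ext v
  have hconst : ∀ (θ : TangentSpace I x [⋀^Fin 1]→L[ℝ] 𝔤)
      (F : Fin 0 → TangentSpace I x [⋀^Fin 2]→L[ℝ] 𝔤), oneTwo L θ F v = oneTwo L θ 0 v :=
    fun θ F => by rw [Subsingleton.elim F 0]
  change transgression L A₂ A₀ x v = transgression L A₂ A₁ x v + transgression L A₁ A₀ x v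
  rw [transgression_apply L hA₀ hA₂, transgression_apply L hA₁ hA₂, transgression_apply L hA₀ hA₁]
  have hsub : (A₂ - A₀) x = (A₂ - A₁) x + (A₁ - A₀) x :=
    (sub_add_sub_cancel (A₂ x) (A₁ x) (A₀ x)).symm
  simp only [hconst, hsub, oneTwo_add_left, intervalIntegral.integral_const, smul_add]

theorem IsInvariantPolynomial.transgression_eq_add_add {m : ℕ}
    {L : ContinuousMultilinearMap ℝ (fun _ : Fin (m + 1 + 1) => 𝔤) W}
    (hL : IsInvariantPolynomial L) {A₀ A₁ A₂ : DiffForm I M 𝔤 1} (hA₀ : IsSmoothForm A₀)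
    (hA₁ : IsSmoothForm A₁) (hA₂ : IsSmoothForm A₂) :
    transgression L A₂ A₀ = transgression L A₂ A₁ + transgression L A₁ A₀ +
      extDerivForm (boundaryForm L A₂ A₁ A₀) := by
  funext x
  ext v
  change transgression L A₂ A₀ x v = transgression L A₂ A₁ x v + transgression L A₁ A₀ x v +
    extDerivForm (boundaryForm L A₂ A₁ A₀) x v
  rw [transgression_apply L hA₀ hA₂, transgression_apply L hA₁ hA₂, transgression_apply L hA₀ hA₁,
    extDerivForm_boundaryForm_apply L hA₀ hA₁ hA₂]
  have ha := hA₁.sub hA₀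
  have hb := hA₂.sub hA₁
  have hab : A₂ - A₀ = (A₁ - A₀) + (A₂ - A₁) := by abel
  have hA₁' : A₁ = A₀ + (A₁ - A₀) := by abel
  set a := A₁ - A₀
  set b := A₂ - A₁
  have hcurv := continuous_curvature_apply hA₀ ha hb x
  let f : ℝ → ℝ → W := fun t s => oneTwo L (a x) (fun _ => curvature (A₀ + t • a + s • b) x) v
  let g : ℝ → ℝ → W := fun t s => oneTwo L (b x) (fun _ => curvature (A₀ + t • a + s • b) x) v
  let f' : ℝ → ℝ → W := fun t s => ∑ j, oneTwo L (a x) (Function.update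
    (fun _ => curvature (A₀ + t • a + s • b) x) j (covDeriv (A₀ + t • a + s • b) b x)) v
  let g' : ℝ → ℝ → W := fun t s => ∑ j, oneTwo L (b x) (Function.update
    (fun _ => curvature (A₀ + t • a + s • b) x) j (covDeriv (A₀ + t • a + s • b) a x)) v
  have hd : ∀ t s, ((m : ℝ) + 1) •
      extDerivForm (polyTwo L b a (curvature (A₀ + t • a + s • b))) x v = f' t s - g' t s := by
    intro t s
    have h := DFunLike.congr_fun (hL.extDerivForm_polyTwo
      ((hA₀.add (ha.smul t)).add (hb.smul s)) ha hb x) v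
    simpa only [ContinuousAlternatingMap.sub_apply, ContinuousAlternatingMap.sum_apply,
      ContinuousAlternatingMap.smul_apply] using h
  have hf : ∀ t s, HasDerivAt (fun s => f t s) (f' t s) s := fun t s =>
    hasDerivAt_oneTwo_apply L (a x)
      (fun w => hasDerivAt_curvature_apply (hA₀.add (ha.smul t)) hb x w s) v
  have hg : ∀ t s, HasDerivAt (fun t => g t s) (g' t s) t := fun t s => by
    have h := hasDerivAt_oneTwo_apply L (b x)
      (fun w => hasDerivAt_curvature_apply (hA₀.add (hb.smul s)) ha x w t) v
    simpa only [f', g', g, add_right_comm A₀ (s • b)] using h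
  have hfc : Continuous (Function.uncurry f) :=
    continuous_oneTwo_apply L (a x) (fun _ w => hcurv w) v
  have hgc : Continuous (Function.uncurry g) :=
    continuous_oneTwo_apply L (b x) (fun _ w => hcurv w) v
  have hf' : Continuous (Function.uncurry f') := continuous_finsetSum _ fun j _ =>
    continuous_oneTwo_update_apply L (a x) hcurv (continuous_covDeriv_apply A₀ a b b x) j v
  have hg' : Continuous (Function.uncurry g') := continuous_finsetSum _ fun j _ =>
    continuous_oneTwo_update_apply L (b x) hcurv (continuous_covDeriv_apply A₀ a b a x) j v
  have : CompleteSpace W := FiniteDimensional.complete ℝ W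
  have green := integral_triangle_sub hf hg hfc hgc hf' hg'
  simp only [← hd, intervalIntegral.integral_smul] at green
  have h1 : ∀ t : ℝ, oneTwo L ((a + b) x) (fun _ => curvature (A₀ + t • (a + b)) x) v =
      f t t + g t t := fun t => by
    rw [smul_add, ← add_assoc]
    exact oneTwo_add_left L (a x) (b x) _ v
  have h2 : ∀ t : ℝ, oneTwo L (b x) (fun _ => curvature (A₁ + t • b) x) v = g 1 t := fun t => by
    change _ = oneTwo L (b x) (fun _ => curvature (A₀ + (1 : ℝ) • a + t • b) x) v
    rw [one_smul, ← hA₁']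
  have h3 : ∀ t : ℝ, oneTwo L (a x) (fun _ => curvature (A₀ + t • a) x) v = f t 0 := fun t => by
    change _ = oneTwo L (a x) (fun _ => curvature (A₀ + t • a + (0 : ℝ) • b) x) v
    rw [zero_smul, add_zero]
  rw [hab]
  simp only [h1, h2, h3]
  rw [mul_comm, mul_smul, Nat.cast_add_one, green, ← smul_add, ← smul_add]
  congr 1
  abel

end Main

theorem eq_add_add_extDerivForm_of_pullbackForm
    {E : Type*} [NormedAddCommGroup E] [NormedSpace ℝ E]
    {H : Type*} [TopologicalSpace H] {I : ModelWithCorners ℝ E H}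
    {M : Type*} [TopologicalSpace M] [ChartedSpace H M] [IsManifold I ∞ M]
    {E' : Type*} [NormedAddCommGroup E'] [NormedSpace ℝ E']
    {H' : Type*} [TopologicalSpace H'] {J : ModelWithCorners ℝ E' H'}
    {B : Type*} [TopologicalSpace B] [ChartedSpace H' B] [IsManifold J ∞ B]
    {F : Type*} [NormedAddCommGroup F] [NormedSpace ℝ F] {k : ℕ}
    {π : M → B} (hπ : ContMDiff I J ∞ π) (hsurj : Function.Surjective π)
    (hd : ∀ x, Function.Surjective (mfderiv I J π x)) {α β γ : DiffForm J B F (k + 1)}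
    {δ : DiffForm J B F k} (hδ : IsSmoothForm δ)
    (h : pullbackForm π α = pullbackForm π β + pullbackForm π γ +
      extDerivForm (pullbackForm (I := I) π δ)) :
    α = β + γ + extDerivForm δ := by
  funext y
  obtain ⟨x, rfl⟩ := hsurj y
  ext w
  choose v hv using fun i => hd x (w i)
  have hw : w = mfderiv I J π x ∘ v := funext fun i => (hv i).symm
  rw [extDerivForm_pullbackForm hπ hδ] at h
  rw [hw]
  exact DFunLike.congr_fun (congrFun h x) v

theorem mainTheorem1
    {E : Type*} [NormedAddCommGroup E] [NormedSpace ℝ E] [FiniteDimensional ℝ E]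
    {H : Type*} [TopologicalSpace H] (I : ModelWithCorners ℝ E H)
    {M : Type*} [TopologicalSpace M] [ChartedSpace H M] [IsManifold I ∞ M]
    {E' : Type*} [NormedAddCommGroup E'] [NormedSpace ℝ E'] [FiniteDimensional ℝ E']
    {H' : Type*} [TopologicalSpace H'] (J : ModelWithCorners ℝ E' H')
    {B : Type*} [TopologicalSpace B] [ChartedSpace H' B] [IsManifold J ∞ B]
    {𝔤 : Type*} [NormedLieRing 𝔤] [NormedLieAlgebra 𝔤] [FiniteDimensional ℝ 𝔤]
    {W : Type*} [NormedAddCommGroup W] [NormedSpace ℝ W] [FiniteDimensional ℝ W]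
    (n : ℕ) (L : ContinuousMultilinearMap ℝ (fun _ : Fin (n + 1) => 𝔤) W)
    (hL : IsInvariantPolynomial L)
    (A₀ A₁ A₂ : DiffForm I M 𝔤 1)
    (hA₀ : IsSmoothForm A₀) (hA₁ : IsSmoothForm A₁) (hA₂ : IsSmoothForm A₂) :
    -- the triangle equation on `M`
    (IsSmoothForm (boundaryForm L A₂ A₁ A₀) ∧
      transgression L A₂ A₀ =
        transgression L A₂ A₁ + transgression L A₁ A₀ +
          extDerivForm (boundaryForm L A₂ A₁ A₀)) ∧
    -- if `M` is the total space of a bundle over `B`: the triangle equation on the base `B`,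
    -- for the forms on `B` whose pullbacks are the forms above
    (∀ π : M → B, ContMDiff I J ∞ π → Function.Surjective π →
      (∀ x, Function.Surjective (mfderiv I J π x)) →
      ∀ (q₂₀ q₂₁ q₁₀ : DiffForm J B W (2 * n + 1)) (q₂₁₀ : DiffForm J B W (2 * n)),
        IsSmoothForm q₂₁₀ →
        pullbackForm π q₂₀ = transgression L A₂ A₀ →
        pullbackForm π q₂₁ = transgression L A₂ A₁ →
        pullbackForm π q₁₀ = transgression L A₁ A₀ →
        pullbackForm π q₂₁₀ = boundaryForm L A₂ A₁ A₀ →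
        q₂₀ = q₂₁ + q₁₀ + extDerivForm q₂₁₀) := by
  have key : transgression L A₂ A₀ = transgression L A₂ A₁ + transgression L A₁ A₀ +
      extDerivForm (boundaryForm L A₂ A₁ A₀) := by
    cases n with
    | zero =>
      have h0 : extDerivForm (boundaryForm L A₂ A₁ A₀) = 0 := extDerivForm_zero
      rw [transgression_eq_add_add_of_zero L hA₀ hA₁ hA₂, h0, add_zero]
    | succ m => exact hL.transgression_eq_add_add hA₀ hA₁ hA₂
  refine ⟨⟨IsSmoothForm.boundaryForm L hA₀ hA₁ hA₂, key⟩, ?_⟩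
  intro π hπ hsurj hd q₂₀ q₂₁ q₁₀ q₂₁₀ hq h₂₀ h₂₁ h₁₀ h₂₁₀
  refine eq_add_add_extDerivForm_of_pullbackForm hπ hsurj hd hq ?_
  rw [h₂₀, h₂₁, h₁₀, h₂₁₀, key]
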